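/- Let $\mathcal G$ be an étale groupoid: a topological groupoid with locally compact Hausdorff spaces of arrows $\mathcal G$ and of units $X=\mathcal G^{(0)}$, whose range map $r:\mathcal G\to X$ is a local homeomorphism; $s$ is the source map and $\mathcal G^x=r^{-1}(x)$. *Reduced $C^*$-algebra.* Let $\mathcal E_{\mathcal G}$ be the Hilbert $C_0(X)$-module obtained by completing $C_c(\mathcal G)$ with respect to the inner product $\langle\xi,\eta\rangle(x)=\sum_{\gamma\in\mathcal G^{x}}\overline{\xi(\gamma)}\,\eta(\gamma)$, with module structure $(\xi\varphi)(\gamma)=\xi(\gamma)\varphi(r(\gamma))$, and let $\mathcal B(\mathcal E_{\mathcal G})$ be the $C^*$-algebra of its adjointable operators. For $f\in C_c(\mathcal G)$ let $\Lambda_{\mathcal G}(f)\in\mathcal B(\mathcal E_{\mathcal G})$ be given by $(\Lambda_{\mathcal G}(f)\xi)(\gamma)=\sum_{\gamma_1\in\mathcal G^{r(\gamma)}}f(\gamma^{-1}\gamma_1)\,\xi(\gamma_1)$. The reduced $C^*$-algebra $C^*_r(\mathcal G)$ is the $C^*$-subalgebra of $\mathcal B(\mathcal E_{\mathcal G})$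 generated by $\Lambda_{\mathcal G}(C_c(\mathcal G))$. *Uniform Roe algebra.* Let $\mathcal G*_r\mathcal G=\{(\gamma,\gamma_1): r(\gamma)=r(\gamma_1)\}$. A tube is a subset of $\mathcal G*_r\mathcal G$ whose image under $(\gamma,\gamma_1)\mapsto\gamma^{-1}\gamma_1$ is relatively compact in $\mathcal G$. Let $\mathcal C_t(\mathcal G*_r\mathcal G)$ be the space of bounded continuous functions $k:\mathcal G*_r\mathcal G\to\mathbb C$ with support in a tube, and for such $k$ let $T(k)\in\mathcal B(\mathcal E_{\mathcal G})$ be given by $(T(k)\xi)(\gamma)=\sum_{\gamma_1\in\mathcal G^{r(\gamma)}}k(\gamma,\gamma_1)\,\xi(\gamma_1)$. The uniform Roe algebra $C^*_u(\mathcal G)$ is the $C^*$-subalgebra of $\mathcal B(\mathcal E_{\mathcal G})$ generated by all $T(k)$, $k\in\mathcal C_t(\mathcal G*_r\mathcal G)$. Since $\Lambda_{\mathcal G}(f)=T\big((\gamma,\gamma_1)\mapsto f(\gamma^{-1}\gamma_1)\big)$, it contains $C^*_r(\mathcal G)$. *The groupoid $\beta_r\mathcal G\rtimes\mathcal G$.*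 Let $\beta_r\mathcal G$ be the Gelfand spectrum of the commutative $C^*$-algebra of all bounded continuous $f:\mathcal G\to\mathbb C$ such that for every $\varepsilon>0$ there is a compact $K\subseteq X$ with $|f(\gamma)|\le\varepsilon$ for all $\gamma\notin r^{-1}(K)$. It carries the map $i:\mathcal G\to\beta_r\mathcal G$ (evaluation at points), the continuous proper surjection $q:\beta_r\mathcal G\to X$ with $q\circ i=r$ (characterized by $z(\varphi\circ r)=\varphi(q(z))$ for $\varphi\in C_0(X)$), and the continuous action of $\mathcal G$ (where $\gamma z$ is defined if $s(\gamma)=q(z)$) extending left multiplication: $\gamma\, i(\eta)=i(\gamma\eta)$. The semi-direct product $\beta_r\mathcal G\rtimes\mathcal G=\{(z,\gamma)\in\beta_r\mathcal G\times\mathcal G: q(z)=r(\gamma)\}$ is the étale groupoid with unit space $\beta_r\mathcal G$, range $(z,\gamma)\mapsto z$, source $(z,\gamma)\mapsto\gamma^{-1}z$, product $(z,\gamma)(\gamma^{-1}z,\gamma_1)=(z,\gamma\gamma_1)$ and inverse $(z,\gamma)^{-1}=(\gamma^{-1}z,\gamma^{-1})$. Write $\Lambda'=\Lambda_{\beta_r\mathcal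 G\rtimes\mathcal G}$ and $\pi(z,\gamma)=\gamma$. For $f\in C_c(\beta_r\mathcal G\rtimes\mathcal G)$ let $\Theta(f)\in\mathcal C_t(\mathcal G*_r\mathcal G)$ be the function $\Theta(f)(\gamma,\gamma_1)=f\big(i(\gamma^{-1}),\gamma^{-1}\gamma_1\big)$. **Theorem.** For every étale groupoid $\mathcal G$ the map $\Lambda'(f)\mapsto T(\Theta(f))$, $f\in C_c(\beta_r\mathcal G\rtimes\mathcal G)$, extends to a $*$-isomorphism $\Phi$ from $C^*_r(\beta_r\mathcal G\rtimes\mathcal G)$ onto the uniform Roe algebra $C^*_u(\mathcal G)$. This isomorphism restricts to the identity on $C^*_r(\mathcal G)$: the map $\Lambda_{\mathcal G}(f)\mapsto\Lambda'(f\circ\pi)$, $f\in C_c(\mathcal G)$, extends to an isometric $*$-homomorphism $\iota:C^*_r(\mathcal G)\to C^*_r(\beta_r\mathcal G\rtimes\mathcal G)$, and $\Phi(\iota(a))=a$ in $\mathcal B(\mathcal E_{\mathcal G})$ for all $a\in C^*_r(\mathcal G)$. -/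

import Mathlib

open Set Filter Topology
open scoped ZeroAtInfty CompactlySupported BoundedContinuousFunction ComplexOrder ENNReal lp

noncomputable section

/-! ## The order on `C₀(X)` -/

namespace ZeroAtInftyContinuousMap

variable {X : Type*} [TopologicalSpace X]

/-- The pointwise order on `C₀(X)`. -/
instance instPartialOrderComplex : PartialOrder C₀(X, ℂ) :=
  PartialOrder.lift (fun f => (f : X → ℂ)) DFunLike.coe_injective

theorem le_iff_forall_complex {f g : C₀(X, ℂ)} : f ≤ g ↔ ∀ x, f x ≤ g x := Iff.rfl

instance instStarOrderedRingComplex : StarOrderedRing C₀(X, ℂ) := by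
  refine StarOrderedRing.of_nonneg_iff' (fun {f g} hfg h x => ?_) (fun f => ⟨fun hf => ?_, ?_⟩)
  · exact add_le_add (le_refl (h x)) (hfg x)
  · have hre : ∀ x, f x = ((f x).re : ℂ) := fun x => (Complex.eq_re_of_ofReal_le (hf x))
    have h0 : ∀ x, 0 ≤ (f x).re := fun x => (Complex.le_def.1 (hf x)).1
    refine ⟨⟨⟨fun x => ((Real.sqrt (f x).re : ℝ) : ℂ), by fun_prop⟩, ?_⟩, ?_⟩
    · have h1 := f.zero_at_infty'
      have h2 : Continuous fun z : ℂ => ((Real.sqrt z.re : ℝ) : ℂ) := by fun_prop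
      have h3 := (h2.tendsto 0).comp h1
      simpa [Function.comp_def] using h3
    · ext x
      simp only [mul_apply, star_apply, coe_mk]
      rw [RCLike.star_def, Complex.conj_ofReal, ← Complex.ofReal_mul, Real.mul_self_sqrt (h0 x)]
      exact hre x
  · rintro ⟨g, rfl⟩ x
    simpa using star_mul_self_nonneg (g x)

end ZeroAtInftyContinuousMap

/-! ## Adjointable operators on a Hilbert `C⋆`-module -/

section Adjointable

variable (A E : Type*) [NonUnitalCStarAlgebra A] [PartialOrder A]
  [NormedAddCommGroup E] [NormedSpace ℂ E] [SMul A E] [CStarModule A E]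

/-- The algebra of bounded operators on the Hilbert `A`-module `E` that have an adjoint. -/
def adjointableSubalgebra : Subalgebra ℂ (E →L[ℂ] E) where
  carrier := {T | ∃ S : E →L[ℂ] E, ∀ ξ η : E, inner A (T ξ) η = inner A ξ (S η)}
  mul_mem' := by
    rintro T T' ⟨S, hS⟩ ⟨S', hS'⟩
    exact ⟨S' * S, fun ξ η => by simp [hS, hS']⟩
  add_mem' := by
    rintro T T' ⟨S, hS⟩ ⟨S', hS'⟩
    exact ⟨S + S', fun ξ η => by simp [hS, hS']⟩
  algebraMap_mem' c := ⟨star c • 1, fun ξ η => by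
    simp [Algebra.algebraMap_eq_smul_one]⟩

/-- The `C⋆`-algebra `𝓑_A(E)` of adjointable operators on the Hilbert `A`-module `E`. -/
def Adjointable : Type _ := ↥(adjointableSubalgebra A E)

namespace Adjointable

instance : NormedRing (Adjointable A E) :=
  inferInstanceAs (NormedRing ↥(adjointableSubalgebra A E))

instance : NormedAlgebra ℂ (Adjointable A E) :=
  inferInstanceAs (NormedAlgebra ℂ ↥(adjointableSubalgebra A E))

variable {A E}

/-- The bounded operator underlying an adjointable operator. -/
def toCLM : Adjointable A E →ₐ[ℂ] (E →L[ℂ] E) := (adjointableSubalgebra A E).val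

/-- An adjointable operator from a pair of mutually adjoint operators. -/
def mk (T S : E →L[ℂ] E) (h : ∀ ξ η : E, inner A (T ξ) η = inner A ξ (S η)) :
    Adjointable A E := ⟨T, S, h⟩

@[simp] theorem toCLM_mk (T S : E →L[ℂ] E)
    (h : ∀ ξ η : E, inner A (T ξ) η = inner A ξ (S η)) : (mk T S h).toCLM = T := rfl

theorem ext {T S : Adjointable A E} (h : T.toCLM = S.toCLM) : T = S := Subtype.ext h

theorem norm_toCLM (T : Adjointable A E) : ‖T.toCLM‖ = ‖T‖ := rfl

theorem isometry_toCLM : Isometry (toCLM : Adjointable A E → (E →L[ℂ] E)) :=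
  isometry_subtype_coe

theorem ext_inner {S S' : E →L[ℂ] E} (h : ∀ ξ η : E, inner A ξ (S η) = inner A ξ (S' η)) :
    S = S' := by
  ext η
  rw [← sub_eq_zero, ← CStarModule.inner_self (A := A), CStarModule.inner_sub_right, h, sub_self]

/-- The adjoint of an adjointable operator, characterized by `⟪T ξ, η⟫ = ⟪ξ, T⋆ η⟫`. -/
instance : Star (Adjointable A E) where
  star T := mk T.2.choose T.1 fun ξ η => by
    rw [← CStarModule.star_inner, ← T.2.choose_spec, CStarModule.star_inner]

theorem inner_star (T : Adjointable A E) (ξ η : E) :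
    inner A (T.toCLM ξ) η = inner A ξ ((star T).toCLM η) := T.2.choose_spec ξ η

theorem inner_star' (T : Adjointable A E) (ξ η : E) :
    inner A ((star T).toCLM ξ) η = inner A ξ (T.toCLM η) := by
  rw [← CStarModule.star_inner, ← inner_star, CStarModule.star_inner]

theorem eq_star {T S : Adjointable A E}
    (h : ∀ ξ η : E, inner A (T.toCLM ξ) η = inner A ξ (S.toCLM η)) : star T = S :=
  ext (ext_inner (A := A) fun ξ η => by rw [← inner_star, h])

instance : StarRing (Adjointable A E) where
  star_involutive T := eq_star fun ξ η => inner_star' T ξ η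
  star_mul T S := eq_star fun ξ η => by simp [inner_star]
  star_add T S := eq_star fun ξ η => by simp [inner_star]

instance : StarModule ℂ (Adjointable A E) where
  star_smul c T := eq_star fun ξ η => by simp [inner_star]

variable [StarOrderedRing A]

theorem norm_sq_le (T : Adjointable A E) : ‖T‖ * ‖T‖ ≤ ‖star T * T‖ := by
  have key : ‖T‖ ≤ √‖star T * T‖ := by
    refine ContinuousLinearMap.opNorm_le_bound T.toCLM (Real.sqrt_nonneg _) fun ξ => ?_
    have h : ‖T.toCLM ξ‖ ^ 2 ≤ ‖star T * T‖ * ‖ξ‖ ^ 2 := by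
      rw [CStarModule.norm_sq_eq A, inner_star]
      calc _ ≤ ‖ξ‖ * ‖(star T).toCLM (T.toCLM ξ)‖ := CStarModule.norm_inner_le E
        _ ≤ ‖ξ‖ * (‖star T * T‖ * ‖ξ‖) := by
          gcongr
          have := (star T * T).toCLM.le_opNorm ξ
          rwa [norm_toCLM, map_mul] at this
        _ = _ := by ring
    calc ‖T.toCLM ξ‖ = √(‖T.toCLM ξ‖ ^ 2) := (Real.sqrt_sq (norm_nonneg _)).symm
      _ ≤ √(‖star T * T‖ * ‖ξ‖ ^ 2) := Real.sqrt_le_sqrt h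
      _ = √‖star T * T‖ * ‖ξ‖ := by
        have := Real.sqrt_mul (norm_nonneg (star T * T)) (‖ξ‖ ^ 2)
        rwa [Real.sqrt_sq (norm_nonneg _)] at this
  calc ‖T‖ * ‖T‖ ≤ √‖star T * T‖ * √‖star T * T‖ := by gcongr
    _ = _ := Real.mul_self_sqrt (norm_nonneg _)

instance : CStarRing (Adjointable A E) where
  norm_mul_self_le := norm_sq_le

instance [CompleteSpace E] : CompleteSpace (Adjointable A E) := by
  refine Metric.complete_of_cauchySeq_tendsto fun u hu => ?_
  have hu1 : CauchySeq fun n => (u n).toCLM := isometry_toCLM.uniformContinuous.comp_cauchySeq hu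
  have hu2 : CauchySeq fun n => (star (u n)).toCLM := by
    have h : UniformContinuous (star : Adjointable A E → Adjointable A E) := by
      refine (LipschitzWith.of_dist_le_mul (K := 1) fun a b => ?_).uniformContinuous
      rw [dist_eq_norm, dist_eq_norm, ← star_sub, norm_star, NNReal.coe_one, one_mul]
    exact (isometry_toCLM.uniformContinuous.comp h).comp_cauchySeq hu
  obtain ⟨T, hT⟩ := cauchySeq_tendsto_of_complete hu1
  obtain ⟨S, hS⟩ := cauchySeq_tendsto_of_complete hu2
  have e (η : E) : Continuous fun R : E →L[ℂ] E => R η := by fun_prop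
  have h (ξ η : E) : inner A (T ξ) η = inner A ξ (S η) := by
    have h1 : Tendsto (fun n => inner A ((u n).toCLM ξ) η) atTop (𝓝 (inner A (T ξ) η)) :=
      ((CStarModule.continuous_inner (A := A) (E := E)).tendsto (T ξ, η)).comp
        ((((e ξ).tendsto T).comp hT).prodMk_nhds tendsto_const_nhds)
    have h2 : Tendsto (fun n => inner A ξ ((star (u n)).toCLM η)) atTop
        (𝓝 (inner A ξ (S η))) :=
      ((CStarModule.continuous_inner (A := A) (E := E)).tendsto (ξ, S η)).comp
        (tendsto_const_nhds.prodMk_nhds (((e η).tendsto S).comp hS))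
    simp_rw [inner_star] at h1
    exact tendsto_nhds_unique h1 h2
  exact ⟨mk T S h, isometry_toCLM.isEmbedding.tendsto_nhds_iff.2 hT⟩

instance [CompleteSpace E] : CStarAlgebra (Adjointable A E) where

end Adjointable

end Adjointable

/-! ## Étale groupoids -/

/-- An étale groupoid with space of arrows `G` and space of units `X` (the topological assumptions
on `G` and `X`, i.e. locally compact and Hausdorff, are imposed where the notion is used).

The unit space is given as a space `X` together with the unit map `e : X → G`; since `r ∘ e = id`,
`e` is a homeomorphism onto the set `G⁽⁰⁾ = e(X)` of units with the topology induced from `G`.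
The product `mul γ₁ γ₂` is meaningful only if `s γ₁ = r γ₂`. -/
structure EtaleGroupoid (G X : Type*) [TopologicalSpace G] [TopologicalSpace X] where
  /-- the range map -/
  r : G → X
  /-- the source map -/
  s : G → X
  /-- the inclusion of the units -/
  e : X → G
  /-- the inverse -/
  inv : G → G
  /-- the composition law, relevant on composable pairs only -/
  mul : G → G → G
  r_e : ∀ x, r (e x) = x
  s_e : ∀ x, s (e x) = x
  r_inv : ∀ γ, r (inv γ) = s γ
  s_inv : ∀ γ, s (inv γ) = r γ
  r_mul : ∀ γ₁ γ₂, s γ₁ = r γ₂ → r (mul γ₁ γ₂) = r γ₁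
  s_mul : ∀ γ₁ γ₂, s γ₁ = r γ₂ → s (mul γ₁ γ₂) = s γ₂
  mul_assoc : ∀ γ₁ γ₂ γ₃, s γ₁ = r γ₂ → s γ₂ = r γ₃ →
    mul (mul γ₁ γ₂) γ₃ = mul γ₁ (mul γ₂ γ₃)
  e_mul : ∀ γ, mul (e (r γ)) γ = γ
  mul_e : ∀ γ, mul γ (e (s γ)) = γ
  mul_inv : ∀ γ, mul γ (inv γ) = e (r γ)
  inv_mul : ∀ γ, mul (inv γ) γ = e (s γ)
  continuous_e : Continuous e
  continuous_inv : Continuous inv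
  continuousOn_mul : ContinuousOn (fun p : G × G => mul p.1 p.2) {p | s p.1 = r p.2}
  isLocalHomeomorph_r : IsLocalHomeomorph r

namespace EtaleGroupoid

variable {G X : Type*} [TopologicalSpace G] [TopologicalSpace X] (𝒢 : EtaleGroupoid G X)

theorem continuous_r : Continuous 𝒢.r := 𝒢.isLocalHomeomorph_r.continuous

theorem continuous_s : Continuous 𝒢.s := by
  have : 𝒢.s = 𝒢.r ∘ 𝒢.inv := funext fun γ => (𝒢.r_inv γ).symm
  rw [this]
  exact 𝒢.continuous_r.comp 𝒢.continuous_inv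

theorem inv_mul_cancel_left (a b : G) (h : 𝒢.r a = 𝒢.r b) :
    𝒢.mul a (𝒢.mul (𝒢.inv a) b) = b := by
  rw [← 𝒢.mul_assoc _ _ _ (𝒢.r_inv a).symm ((𝒢.s_inv a).trans h), 𝒢.mul_inv, h, 𝒢.e_mul]

theorem mul_cancel_left (a b : G) (h : 𝒢.s a = 𝒢.r b) :
    𝒢.mul (𝒢.inv a) (𝒢.mul a b) = b := by
  rw [← 𝒢.mul_assoc _ _ _ (𝒢.s_inv a) h, 𝒢.inv_mul, h, 𝒢.e_mul]

theorem inv_inv (a : G) : 𝒢.inv (𝒢.inv a) = a := by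
  have h := 𝒢.mul_cancel_left (𝒢.inv a) a (𝒢.s_inv a)
  rwa [𝒢.inv_mul, ← 𝒢.r_inv, ← 𝒢.s_inv (𝒢.inv a), 𝒢.mul_e] at h

theorem inv_eq_of_mul (a b : G) (h : 𝒢.s a = 𝒢.r b) (hm : 𝒢.mul a b = 𝒢.e (𝒢.r a)) :
    𝒢.inv a = b := by
  have := 𝒢.mul_cancel_left a b h
  rw [hm] at this
  rw [← this, ← 𝒢.s_inv a, 𝒢.mul_e]

/-- The fibre `𝒢ˣ = r⁻¹(x)`. -/
abbrev Fiber (x : X) : Type _ := {γ : G // 𝒢.r γ = x}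

/-- A compact set meets the fibres of `r` in a uniformly bounded number of points. -/
theorem exists_card_bound {K : Set G} (hK : IsCompact K) :
    ∃ N : ℕ, ∀ x, ∃ F : Finset G, F.card ≤ N ∧ ∀ γ ∈ K, 𝒢.r γ = x → γ ∈ F := by
  classical
  have h := 𝒢.isLocalHomeomorph_r
  obtain ⟨t, -, ht⟩ := hK.elim_nhds_subcover (fun γ => (h.localInverseAt γ).target)
    fun γ _ => (h.localInverseAt γ).open_target.mem_nhds (by simp)
  refine ⟨t.card, fun x => ⟨t.image fun γ => h.localInverseAt γ x, Finset.card_image_le, ?_⟩⟩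
  rintro γ hγ rfl
  obtain ⟨γ₀, hγ₀, hγt⟩ := mem_iUnion₂.1 (ht hγ)
  refine Finset.mem_image.2 ⟨γ₀, hγ₀, ?_⟩
  simpa using (h.localInverseAt γ₀).right_inv hγt

/-- Continuity of sums over the fibres of `r`. -/
theorem continuous_fibreSum [T2Space G] [T2Space X] {Y : Type*} [TopologicalSpace Y] {p : Y → X}
    (hp : Continuous p) {F : Y → G → ℂ}
    (hF : ContinuousOn (fun z : Y × G => F z.1 z.2) {z | p z.1 = 𝒢.r z.2})
    {K : Set G} (hK : IsCompact K) (hFK : ∀ y γ, 𝒢.r γ = p y → F y γ ≠ 0 → γ ∈ K) :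
    Continuous fun y => ∑' γ : 𝒢.Fiber (p y), F y γ := by
  classical
  rw [continuous_iff_continuousAt]
  intro y₀
  set h := 𝒢.isLocalHomeomorph_r
  obtain ⟨N, hN⟩ := 𝒢.exists_card_bound hK
  -- the finitely many points of `K` over `p y₀`
  obtain ⟨F₀, hF₀⟩ : ∃ F₀ : Finset G, ∀ γ, γ ∈ F₀ ↔ γ ∈ K ∧ 𝒢.r γ = p y₀ := by
    obtain ⟨F₁, -, h₁⟩ := hN (p y₀)
    exact ⟨F₁.filter (fun γ => γ ∈ K ∧ 𝒢.r γ = p y₀), fun γ => by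
      simp only [Finset.mem_filter, and_iff_right_iff_imp]
      exact fun hγ => h₁ γ hγ.1 hγ.2⟩
  let S : G → X → G := fun γ => h.localInverseAt γ
  have hSr : ∀ γ ∈ F₀, ∀ᶠ x in 𝓝 (p y₀), 𝒢.r (S γ x) = x := by
    intro γ hγ
    have h1 : 𝒢.r γ ∈ (h.localInverseAt γ).source := by simp
    rw [← ((hF₀ γ).1 hγ).2]
    filter_upwards [(h.localInverseAt γ).open_source.mem_nhds h1] with x hx
    exact h.apply_localInverseAt_of_mem hx
  have hSc : ∀ γ ∈ F₀, ContinuousAt (S γ) (p y₀) := by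
    intro γ hγ
    rw [← ((hF₀ γ).1 hγ).2]
    exact (h.localInverseAt γ).continuousAt (by simp)
  have hS0 : ∀ γ ∈ F₀, S γ (p y₀) = γ := by
    intro γ hγ
    rw [← ((hF₀ γ).1 hγ).2]
    exact h.localInverseAt_apply_self ..
  -- near `p y₀` the points of `K` are among the values of the local sections
  have hcover : ∀ᶠ x in 𝓝 (p y₀), ∀ γ ∈ K, 𝒢.r γ = x → ∃ γ₀ ∈ F₀, S γ₀ x = γ := by
    let U : Set G := ⋃ γ₀ ∈ F₀, (h.localInverseAt γ₀).target
    have hU : IsOpen U := isOpen_biUnion fun γ₀ _ => (h.localInverseAt γ₀).open_target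
    have hC : IsClosed (𝒢.r '' (K \ U)) := ((hK.diff hU).image 𝒢.continuous_r).isClosed
    have hx : p y₀ ∉ 𝒢.r '' (K \ U) := by
      rintro ⟨γ, ⟨hγK, hγU⟩, hγ⟩
      exact hγU (mem_biUnion ((hF₀ γ).2 ⟨hγK, hγ⟩) (by simp))
    filter_upwards [hC.isOpen_compl.mem_nhds hx] with x hx γ hγK hγx
    have : γ ∈ U := by
      by_contra hγ
      exact hx ⟨γ, ⟨hγK, hγ⟩, hγx⟩
    obtain ⟨γ₀, hγ₀, hγ⟩ := mem_iUnion₂.1 this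
    refine ⟨γ₀, hγ₀, ?_⟩
    rw [← hγx]
    have := (h.localInverseAt γ₀).right_inv hγ
    simpa using this
  have hinj : ∀ᶠ x in 𝓝 (p y₀), Set.InjOn (fun γ => S γ x) F₀ := by
    have : ∀ γ ∈ F₀, ∀ γ' ∈ F₀, ∀ᶠ x in 𝓝 (p y₀), γ ≠ γ' → S γ x ≠ S γ' x := by
      intro γ hγ γ' hγ'
      by_cases hne : γ = γ'
      · simp [hne]
      · have hne' : S γ (p y₀) ≠ S γ' (p y₀) := by rwa [hS0 γ hγ, hS0 γ' hγ']
        filter_upwards [((hSc γ hγ).ne_iff_eventually_ne (hSc γ' hγ')).1 hne'] with x hx _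
        exact hx
    filter_upwards [(Filter.eventually_all_finset F₀).2 fun γ hγ =>
      (Filter.eventually_all_finset F₀).2 (this γ hγ)] with x hx γ hγ γ' hγ' he
    by_contra hne
    exact hx γ hγ γ' hγ' hne he
  have key : ∀ᶠ y in 𝓝 y₀, ∑' γ : 𝒢.Fiber (p y), F y γ = ∑ γ ∈ F₀, F y (S γ (p y)) := by
    have e1 := hp.continuousAt.eventually hcover
    have e2 := hp.continuousAt.eventually hinj
    have e3 := hp.continuousAt.eventually ((Filter.eventually_all_finset F₀).2 hSr)
    filter_upwards [e1, e2, e3] with y h1 h2 h3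
    rw [← Finset.sum_image (f := F y) h2]
    have : ∑' γ : 𝒢.Fiber (p y), F y γ = ∑' γ : G, ({γ | 𝒢.r γ = p y} : Set G).indicator (F y) γ :=
      tsum_subtype _ _
    rw [this, tsum_eq_sum (s := F₀.image fun γ => S γ (p y))]
    · refine Finset.sum_congr rfl fun γ hγ => ?_
      obtain ⟨γ₀, hγ₀, rfl⟩ := Finset.mem_image.1 hγ
      exact indicator_of_mem (s := {γ | 𝒢.r γ = p y}) (h3 γ₀ hγ₀) _
    · intro γ hγ
      by_contra hne
      have hm := mem_of_indicator_ne_zero hne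
      rw [indicator_of_mem hm] at hne
      obtain ⟨γ₀, hγ₀, he⟩ := h1 γ (hFK y γ hm hne) hm
      exact hγ (Finset.mem_image.2 ⟨γ₀, hγ₀, he⟩)
  refine ContinuousAt.congr ?_ (key.mono fun y hy => hy.symm)
  refine tendsto_finsetSum _ fun γ hγ => ?_
  have hz : ((y₀, γ) : Y × G) ∈ {z : Y × G | p z.1 = 𝒢.r z.2} := ((hF₀ γ).1 hγ).2.symm
  have h1 := hF _ hz
  have h2 : Tendsto (fun y => (y, S γ (p y))) (𝓝 y₀) (𝓝[{z : Y × G | p z.1 = 𝒢.r z.2}] (y₀, γ)) := by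
    refine tendsto_nhdsWithin_iff.2 ⟨tendsto_id.prodMk_nhds ?_, ?_⟩
    · have := (hSc γ hγ).tendsto.comp hp.continuousAt
      rwa [hS0 γ hγ] at this
    · filter_upwards [hp.continuousAt.eventually (hSr γ hγ)] with y hy
      exact hy.symm
  have h3 := h1.tendsto.comp h2
  simpa [Function.comp_def, hS0 γ hγ] using h3

end EtaleGroupoid

/-! ## Matrix operators on `ℓ²` -/

/-- A matrix with bounded entries and uniformly bounded numbers of nonzero entries in each row and
in each column. -/
structure IsBandMatrix {ι : Type*} (k : ι → ι → ℂ) (C : ℝ) (N : ℕ) : Prop where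
  nonneg : 0 ≤ C
  bound : ∀ i j, ‖k i j‖ ≤ C
  row : ∀ i, ∃ F : Finset ι, F.card ≤ N ∧ ∀ j, k i j ≠ 0 → j ∈ F
  col : ∀ j, ∃ F : Finset ι, F.card ≤ N ∧ ∀ i, k i j ≠ 0 → i ∈ F

namespace IsBandMatrix

variable {ι : Type*} {k : ι → ι → ℂ} {C : ℝ} {N : ℕ}

theorem adjoint (hk : IsBandMatrix k C N) : IsBandMatrix (fun i j => star (k j i)) C N where
  nonneg := hk.nonneg
  bound i j := by simpa using hk.bound j i
  row i := by simpa using hk.col i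
  col j := by simpa using hk.row j

theorem tsum_eq (hk : IsBandMatrix k C N) (ξ : ι → ℂ) (i : ι) :
    ∑' j, k i j * ξ j = ∑ j ∈ (hk.row i).choose, k i j * ξ j :=
  tsum_eq_sum fun j hj => by
    have : k i j = 0 := by
      by_contra h
      exact hj ((hk.row i).choose_spec.2 j h)
    simp [this]

theorem sum_sq_le (hk : IsBandMatrix k C N) (ξ : lp (fun _ : ι => ℂ) 2) (s : Finset ι) :
    ∑ i ∈ s, ‖∑' j, k i j * ξ j‖ ^ 2 ≤ (N * C * ‖ξ‖) ^ 2 := by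
  classical
  set F : ι → Finset ι := fun i => (hk.row i).choose
  set J : Finset ι := s.biUnion F
  have hξ : ∑ j ∈ J, ‖ξ j‖ ^ 2 ≤ ‖ξ‖ ^ 2 := by
    simpa using lp.sum_rpow_le_norm_rpow (p := 2) (by simp) ξ J
  have h1 : ∀ i ∈ s, ‖∑' j, k i j * ξ j‖ ^ 2 ≤ N * ∑ j ∈ J, ‖k i j‖ ^ 2 * ‖ξ j‖ ^ 2 := by
    intro i hi
    rw [hk.tsum_eq]
    calc ‖∑ j ∈ F i, k i j * ξ j‖ ^ 2 ≤ (∑ j ∈ F i, ‖k i j * ξ j‖) ^ 2 := by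
          gcongr; exact norm_sum_le _ _
      _ ≤ (F i).card * ∑ j ∈ F i, ‖k i j * ξ j‖ ^ 2 := sq_sum_le_card_mul_sum_sq
      _ ≤ N * ∑ j ∈ J, ‖k i j * ξ j‖ ^ 2 := by
          gcongr
          · exact (hk.row i).choose_spec.1
          · exact Finset.subset_biUnion_of_mem F hi
      _ = _ := by simp [mul_pow]
  have h2 : ∀ j, ∑ i ∈ s, ‖k i j‖ ^ 2 ≤ N * C ^ 2 := by
    intro j
    obtain ⟨F', hF', h'⟩ := hk.col j
    calc ∑ i ∈ s, ‖k i j‖ ^ 2 = ∑ i ∈ s with k i j ≠ 0, ‖k i j‖ ^ 2 := by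
          rw [Finset.sum_filter_of_ne]
          intro i _ h h0
          simp [h0] at h
      _ ≤ ∑ i ∈ s with k i j ≠ 0, C ^ 2 := by
          gcongr with i
          exact hk.bound i j
      _ = (s.filter fun i => k i j ≠ 0).card * C ^ 2 := by simp
      _ ≤ N * C ^ 2 := by
          gcongr
          refine (Finset.card_le_card fun i hi => ?_).trans hF'
          exact h' i (Finset.mem_filter.1 hi).2
  calc _ ≤ ∑ i ∈ s, N * ∑ j ∈ J, ‖k i j‖ ^ 2 * ‖ξ j‖ ^ 2 := Finset.sum_le_sum h1
    _ = N * ∑ j ∈ J, (∑ i ∈ s, ‖k i j‖ ^ 2) * ‖ξ j‖ ^ 2 := by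
        rw [← Finset.mul_sum, Finset.sum_comm]
        simp_rw [Finset.sum_mul]
    _ ≤ N * ∑ j ∈ J, (N * C ^ 2) * ‖ξ j‖ ^ 2 := by
        gcongr with j
        exact h2 j
    _ = N * (N * C ^ 2) * ∑ j ∈ J, ‖ξ j‖ ^ 2 := by rw [← Finset.mul_sum]; ring
    _ ≤ N * (N * C ^ 2) * ‖ξ‖ ^ 2 := by gcongr
    _ = _ := by ring

/-- The operator `(k ξ)(i) = ∑ⱼ k(i,j) ξ(j)` on `ℓ²`. -/
def toCLM (hk : IsBandMatrix k C N) : lp (fun _ : ι => ℂ) 2 →L[ℂ] lp (fun _ : ι => ℂ) 2 :=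
  LinearMap.mkContinuous
    { toFun := fun ξ => ⟨fun i => ∑' j, k i j * ξ j,
        memℓp_gen' (C := (N * C * ‖ξ‖) ^ 2) fun s => by simpa using hk.sum_sq_le ξ s⟩
      map_add' := fun ξ η => by
        ext i
        change ∑' j, k i j * (ξ j + η j) = ∑' j, k i j * ξ j + ∑' j, k i j * η j
        rw [hk.tsum_eq (fun j => ξ j + η j), hk.tsum_eq, hk.tsum_eq, ← Finset.sum_add_distrib]
        simp_rw [mul_add]
      map_smul' := fun c ξ => by
        ext i
        change ∑' j, k i j * (c * ξ j) = c * ∑' j, k i j * ξ j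
        rw [← tsum_mul_left]
        simp_rw [mul_left_comm] }
    (N * C) fun ξ => by
      have := hk.nonneg
      refine lp.norm_le_of_forall_sum_le (p := 2) (by simp) (by positivity) fun s => ?_
      simpa using hk.sum_sq_le ξ s

theorem toCLM_apply (hk : IsBandMatrix k C N) (ξ : lp (fun _ : ι => ℂ) 2) (i : ι) :
    hk.toCLM ξ i = ∑' j, k i j * ξ j := rfl

theorem norm_toCLM_le (hk : IsBandMatrix k C N) : ‖hk.toCLM‖ ≤ N * C :=
  LinearMap.mkContinuous_norm_le _ (mul_nonneg (Nat.cast_nonneg _) hk.nonneg) _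

theorem inner_toCLM (hk : IsBandMatrix k C N) (ξ η : lp (fun _ : ι => ℂ) 2) :
    inner ℂ (hk.toCLM ξ) η = inner ℂ ξ (hk.adjoint.toCLM η) := by
  classical
  rw [← ContinuousLinearMap.adjoint_inner_right]
  congr 1
  ext i
  have h := lp.inner_single_left (𝕜 := ℂ) i (1 : ℂ) (hk.toCLM.adjoint η)
  rw [ContinuousLinearMap.adjoint_inner_right, lp.inner_eq_tsum] at h
  rw [toCLM_apply]
  simp only [RCLike.inner_apply, map_one, mul_one] at h
  rw [← h]
  refine tsum_congr fun j => ?_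
  rw [toCLM_apply, tsum_eq_single i]
  · simp [mul_comm]
  · intro j' hj'
    simp [lp.single_apply, Pi.single_eq_of_ne hj']

end IsBandMatrix

/-! ## The Hilbert `C₀(X)`-module `ℓ²_{C₀(X)}(𝒢)` -/

namespace EtaleGroupoid

variable {G X : Type*} [TopologicalSpace G] [TopologicalSpace X] (𝒢 : EtaleGroupoid G X)

/-- The Hilbert space `ℓ²(𝒢ˣ)`. -/
abbrev FiberL2 (x : X) : Type _ := lp (fun _ : 𝒢.Fiber x => ℂ) 2

/-- The Banach space of all bounded sections of the field `(ℓ²(𝒢ˣ))ₓ`, with the norm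
`‖ξ‖ = supₓ ‖ξₓ‖`. -/
abbrev Sections : Type _ := lp (fun x : X => 𝒢.FiberL2 x) ∞

theorem memlp_restrict (ξ : C_c(G, ℂ)) (x : X) :
    Memℓp (fun γ : 𝒢.Fiber x => ξ (γ : G)) 2 := by
  refine (memℓp_zero ?_).of_exponent_ge (zero_le (a := (2 : ℝ≥0∞)))
  obtain ⟨N, hN⟩ := 𝒢.exists_card_bound ξ.hasCompactSupport
  obtain ⟨F, -, hF⟩ := hN x
  refine Set.Finite.of_finite_image (f := Subtype.val) (F.finite_toSet.subset ?_)
    Subtype.val_injective.injOn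
  rintro _ ⟨γ, hγ, rfl⟩
  exact hF γ (subset_tsupport _ hγ) γ.2

/-- The restriction of a function in `C_c(𝒢)` to the fibre `𝒢ˣ`. -/
def restrict (ξ : C_c(G, ℂ)) (x : X) : 𝒢.FiberL2 x :=
  ⟨fun γ => ξ (γ : G), 𝒢.memlp_restrict ξ x⟩

variable [T2Space G] [T2Space X]

/-- For `ξ, η ∈ C_c(𝒢)` the function `x ↦ ⟪ξₓ, ηₓ⟫` belongs to `C_c(X)`. -/
def innerCc (ξ η : C_c(G, ℂ)) : C_c(X, ℂ) where
  toFun x := inner ℂ (𝒢.restrict ξ x) (𝒢.restrict η x)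
  continuous_toFun := by
    simp_rw [lp.inner_eq_tsum]
    refine 𝒢.continuous_fibreSum (p := id) continuous_id
      (F := fun _ γ => inner ℂ (ξ γ) (η γ)) ?_ ξ.hasCompactSupport ?_
    · have h1 := ξ.continuous
      have h2 := η.continuous
      exact Continuous.continuousOn (by fun_prop)
    · intro y γ _ h
      refine subset_tsupport _ fun h0 => h ?_
      simp [h0]
  hasCompactSupport' := by
    refine HasCompactSupport.intro (ξ.hasCompactSupport.isCompact.image 𝒢.continuous_r) ?_
    intro x hx
    rw [lp.inner_eq_tsum]
    refine (tsum_congr fun γ => ?_).trans tsum_zero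
    have : ξ (γ : G) = 0 := by
      by_contra h
      exact hx ⟨γ, subset_tsupport _ h, γ.2⟩
    simp [restrict, this]

/-- The canonical map from `C_c(𝒢)` to the bounded sections of the field `(ℓ²(𝒢ˣ))ₓ`. -/
def ofCc : C_c(G, ℂ) →ₗ[ℂ] 𝒢.Sections where
  toFun ξ := ⟨fun x => 𝒢.restrict ξ x, memℓp_infty (by
    obtain ⟨C, hC⟩ := (𝒢.innerCc ξ ξ).hasCompactSupport.exists_bound_of_continuous
      (𝒢.innerCc ξ ξ).continuous
    refine ⟨√C, ?_⟩
    rintro _ ⟨x, rfl⟩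
    refine Real.le_sqrt_of_sq_le ?_
    have h := hC x
    change ‖inner ℂ (𝒢.restrict ξ x) (𝒢.restrict ξ x)‖ ≤ C at h
    simpa [inner_self_eq_norm_sq_to_K] using h)⟩
  map_add' ξ η := rfl
  map_smul' c ξ := rfl

theorem ofCc_apply (ξ : C_c(G, ℂ)) (x : X) (γ : 𝒢.Fiber x) : 𝒢.ofCc ξ x γ = ξ (γ : G) := rfl

/-- The completion of `C_c(𝒢)`, realized as its closure in the bounded sections. -/
def l2Submodule : Submodule ℂ 𝒢.Sections := (LinearMap.range 𝒢.ofCc).topologicalClosure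

/-- The Hilbert `C₀(X)`-module `ℰ = ℓ²_{C₀(X)}(𝒢)`, that is, the completion of `C_c(𝒢)` with
respect to the norm `‖ξ‖² = supₓ ∑_{γ ∈ 𝒢ˣ} |ξ(γ)|²`. -/
def L2 : Type _ := ↥(𝒢.l2Submodule)

namespace L2

instance : NormedAddCommGroup 𝒢.L2 := inferInstanceAs (NormedAddCommGroup ↥(𝒢.l2Submodule))

instance : NormedSpace ℂ 𝒢.L2 := inferInstanceAs (NormedSpace ℂ ↥(𝒢.l2Submodule))

instance : CompleteSpace 𝒢.L2 :=
  (Submodule.isClosed_topologicalClosure (LinearMap.range 𝒢.ofCc)).completeSpace_coe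

variable {𝒢}

/-- The bounded section given by an element of `ℰ`. -/
def val : 𝒢.L2 →ₗᵢ[ℂ] 𝒢.Sections := (𝒢.l2Submodule).subtypeₗᵢ

theorem val_injective : Function.Injective (val : 𝒢.L2 → 𝒢.Sections) := Subtype.val_injective

theorem val_mem (ξ : 𝒢.L2) : val ξ ∈ 𝒢.l2Submodule := ξ.2

variable (𝒢) in
/-- The inclusion of `C_c(𝒢)` in `ℰ`. -/
def incl : C_c(G, ℂ) →ₗ[ℂ] 𝒢.L2 :=
  𝒢.ofCc.codRestrict 𝒢.l2Submodule fun ξ =>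
    Submodule.le_topologicalClosure _ (LinearMap.mem_range_self _ ξ)

theorem val_incl (ξ : C_c(G, ℂ)) : val (incl 𝒢 ξ) = 𝒢.ofCc ξ := rfl

/-- A bounded operator on sections that maps `C_c(𝒢)` to itself restricts to `ℰ`. -/
def restrictCLM (T : 𝒢.Sections →L[ℂ] 𝒢.Sections) (hT : ∀ ξ, ∃ ζ, T (𝒢.ofCc ξ) = 𝒢.ofCc ζ) :
    𝒢.L2 →L[ℂ] 𝒢.L2 :=
  (T.comp (val (𝒢 := 𝒢)).toContinuousLinearMap).codRestrict 𝒢.l2Submodule fun ξ =>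
    map_mem_closure (s := LinearMap.range 𝒢.ofCc) (t := LinearMap.range 𝒢.ofCc)
      T.continuous (val_mem ξ) (by
        rintro _ ⟨ξ, rfl⟩
        obtain ⟨ζ, hζ⟩ := hT ξ
        exact ⟨ζ, hζ.symm⟩)

theorem val_restrictCLM (T : 𝒢.Sections →L[ℂ] 𝒢.Sections)
    (hT : ∀ ξ, ∃ ζ, T (𝒢.ofCc ξ) = 𝒢.ofCc ζ) (ξ : 𝒢.L2) :
    val (restrictCLM T hT ξ) = T (val ξ) := rfl

theorem exists_approx_inner (ξ η : 𝒢.L2) {ε : ℝ} (hε : 0 < ε) :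
    ∃ f : C_c(X, ℂ), ∀ x, ‖inner ℂ (val ξ x) (val η x) - f x‖ < ε := by
  let u : 𝒢.Sections × 𝒢.Sections → ℝ := fun z =>
    ‖val ξ - z.1‖ * ‖val η‖ + ‖z.1‖ * ‖val η - z.2‖
  have hu : Continuous u := by fun_prop
  have h0 : ∀ᶠ z in 𝓝 (val ξ, val η), u z < ε := by
    refine hu.continuousAt.eventually_lt continuousAt_const ?_
    simpa [u] using hε
  have hcl : (val ξ, val η) ∈ closure ((LinearMap.range 𝒢.ofCc : Set 𝒢.Sections) ×ˢ
      (LinearMap.range 𝒢.ofCc : Set 𝒢.Sections)) := by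
    rw [closure_prod_eq]
    exact ⟨val_mem ξ, val_mem η⟩
  obtain ⟨⟨_, _⟩, hz, ⟨ξ', rfl⟩, ⟨η', rfl⟩⟩ := mem_closure_iff_nhds.1 hcl _ h0
  refine ⟨𝒢.innerCc ξ' η', fun x => lt_of_le_of_lt ?_ hz⟩
  have hn : ∀ (ζ : 𝒢.Sections), ‖ζ x‖ ≤ ‖ζ‖ := fun ζ => lp.norm_apply_le_norm (by simp) ζ x
  have e : inner ℂ (val ξ x) (val η x) - 𝒢.innerCc ξ' η' x
      = inner ℂ ((val ξ - 𝒢.ofCc ξ') x) (val η x)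
        + inner ℂ (𝒢.ofCc ξ' x) ((val η - 𝒢.ofCc η') x) := by
    change _ - inner ℂ (𝒢.ofCc ξ' x) (𝒢.ofCc η' x) = _
    simp only [lp.coeFn_sub, Pi.sub_apply, inner_sub_left, inner_sub_right]
    ring
  rw [e]
  refine (norm_add_le _ _).trans (add_le_add ?_ ?_)
  · exact (norm_inner_le_norm _ _).trans (mul_le_mul (hn _) (hn _) (norm_nonneg _) (norm_nonneg _))
  · exact (norm_inner_le_norm _ _).trans (mul_le_mul (hn _) (hn _) (norm_nonneg _) (norm_nonneg _))

/-- The `C₀(X)`-valued inner product `⟪ξ, η⟫(x) = ∑_{γ ∈ 𝒢ˣ} conj ξ(γ) η(γ)` of `ℰ`. -/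
def innerC0 (ξ η : 𝒢.L2) : C₀(X, ℂ) where
  toFun x := inner ℂ (val ξ x) (val η x)
  continuous_toFun := by
    refine continuous_of_uniform_approx_of_continuous fun s hs => ?_
    obtain ⟨ε, hε, hs⟩ := Metric.mem_uniformity_dist.1 hs
    obtain ⟨f, hf⟩ := exists_approx_inner ξ η hε
    exact ⟨f, f.continuous, fun x => hs (by rw [dist_eq_norm]; exact hf x)⟩
  zero_at_infty' := by
    rw [Metric.tendsto_nhds]
    intro ε hε
    obtain ⟨f, hf⟩ := exists_approx_inner ξ η (half_pos hε)
    filter_upwards [Metric.tendsto_nhds.1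
      f.hasCompactSupport.is_zero_at_infty _ (half_pos hε)] with x hx
    rw [dist_zero_right] at hx ⊢
    calc _ = ‖(inner ℂ (val ξ x) (val η x) - f x) + f x‖ := by rw [sub_add_cancel]
      _ ≤ _ := norm_add_le _ _
      _ < ε / 2 + ε / 2 := add_lt_add (hf x) hx
      _ = ε := add_halves ε

/-- The module structure `(ξ f)(γ) = ξ(γ) f(r(γ))` of `ℰ` over `C₀(X)`. -/
instance : SMul C₀(X, ℂ) 𝒢.L2 where
  smul f := restrictCLM
    (lp.mapCLM ∞ (fun x => f x • ContinuousLinearMap.id ℂ (𝒢.FiberL2 x)) (norm_nonneg f)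
      fun x => by
        rw [norm_smul]
        exact (mul_le_of_le_one_right (norm_nonneg _) ContinuousLinearMap.norm_id_le).trans
          (f.toBCF.norm_coe_le_norm x))
    fun ξ => ⟨⟨⟨fun γ => f (𝒢.r γ) * ξ γ, by
          have h1 := 𝒢.continuous_r
          have h2 := f.continuous
          have h3 := ξ.continuous
          fun_prop⟩, ξ.hasCompactSupport.mul_left⟩, by
        ext x γ
        change f x * ξ γ = f (𝒢.r γ) * ξ γ
        rw [γ.2]⟩

theorem val_smul (f : C₀(X, ℂ)) (ξ : 𝒢.L2) (x : X) : val (f • ξ) x = f x • val ξ x := rfl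

instance : CStarModule C₀(X, ℂ) 𝒢.L2 where
  inner := innerC0
  inner_add_right {ξ η ζ} := by
    ext x
    exact inner_add_right (𝕜 := ℂ) (val ξ x) (val η x) (val ζ x)
  inner_self_nonneg {ξ} x := by
    change 0 ≤ inner ℂ (val ξ x) (val ξ x)
    rw [inner_self_eq_norm_sq_to_K]
    positivity
  inner_self {ξ} := by
    constructor
    · intro h
      refine val_injective (lp.ext (funext fun x => ?_))
      have := DFunLike.congr_fun h x
      exact inner_self_eq_zero.1 this
    · rintro rfl
      ext x
      exact inner_zero_left (𝕜 := ℂ) (E := 𝒢.FiberL2 x) 0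
  inner_op_smul_right {f ξ η} := by
    ext x
    exact inner_smul_right (𝕜 := ℂ) (val ξ x) (val η x) (f x)
  inner_smul_right_complex {c ξ η} := by
    ext x
    exact inner_smul_right (𝕜 := ℂ) (val ξ x) (val η x) c
  star_inner ξ η := by
    ext x
    exact inner_conj_symm (𝕜 := ℂ) (val η x) (val ξ x)
  norm_eq_sqrt_norm_inner_self ξ := by
    have e : ∀ x, ‖innerC0 ξ ξ x‖ = ‖val ξ x‖ ^ 2 := fun x => by
      change ‖inner ℂ (val ξ x) (val ξ x)‖ = _
      simp [inner_self_eq_norm_sq_to_K]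
    have hn : ‖innerC0 ξ ξ‖ = ‖(innerC0 ξ ξ).toBCF‖ := rfl
    refine le_antisymm ?_ ?_
    · change ‖val ξ‖ ≤ _
      refine lp.norm_le_of_forall_le (Real.sqrt_nonneg _) fun x => Real.le_sqrt_of_sq_le ?_
      rw [← e, hn]
      exact (innerC0 ξ ξ).toBCF.norm_coe_le_norm x
    · rw [Real.sqrt_le_left (norm_nonneg _), hn]
      refine (BoundedContinuousFunction.norm_le (sq_nonneg _)).2 fun x => ?_
      change ‖innerC0 ξ ξ x‖ ≤ _
      rw [e]
      exact pow_le_pow_left₀ (norm_nonneg _) (lp.norm_apply_le_norm (by simp) (val ξ) x) 2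

theorem inner_apply (ξ η : 𝒢.L2) (x : X) :
    inner C₀(X, ℂ) ξ η x = inner ℂ (val ξ x) (val η x) := rfl

end L2

end EtaleGroupoid

/-! ## Kernels supported in tubes, the uniform and the reduced `C⋆`-algebra -/

namespace EtaleGroupoid

variable {G X : Type*} [TopologicalSpace G] [TopologicalSpace X] (𝒢 : EtaleGroupoid G X)

/-- The space `𝒢 *_r 𝒢` of pairs of arrows with the same range. -/
abbrev RangePairs : Type _ := {p : G × G // 𝒢.r p.1 = 𝒢.r p.2}

/-- The map `(γ, γ₁) ↦ γ⁻¹ γ₁` on `𝒢 *_r 𝒢`. -/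
def leftDiv (p : 𝒢.RangePairs) : G := 𝒢.mul (𝒢.inv p.1.1) p.1.2

theorem continuous_leftDiv : Continuous 𝒢.leftDiv := by
  have h : Continuous fun p : 𝒢.RangePairs => (𝒢.inv p.1.1, p.1.2) := by
    have := 𝒢.continuous_inv
    fun_prop
  exact 𝒢.continuousOn_mul.comp_continuous h fun p => (𝒢.s_inv _).trans p.2

theorem inv_leftDiv (p : 𝒢.RangePairs) :
    𝒢.inv (𝒢.leftDiv p) = 𝒢.mul (𝒢.inv p.1.2) p.1.1 := by
  have h1 : 𝒢.s (𝒢.inv p.1.1) = 𝒢.r p.1.2 := (𝒢.s_inv _).trans p.2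
  have h2 : 𝒢.s (𝒢.inv p.1.2) = 𝒢.r p.1.1 := (𝒢.s_inv _).trans p.2.symm
  have h3 : 𝒢.r (𝒢.mul (𝒢.inv p.1.2) p.1.1) = 𝒢.s p.1.2 := by rw [𝒢.r_mul _ _ h2, 𝒢.r_inv]
  refine 𝒢.inv_eq_of_mul _ _ ((𝒢.s_mul _ _ h1).trans h3.symm) ?_
  change 𝒢.mul (𝒢.mul _ _) _ = 𝒢.e (𝒢.r (𝒢.mul _ _))
  rw [𝒢.mul_assoc _ _ _ h1 h3.symm, 𝒢.inv_mul_cancel_left _ _ p.2.symm, 𝒢.inv_mul,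
    𝒢.r_mul _ _ h1, 𝒢.r_inv]

/-- A tube is a subset of `𝒢 *_r 𝒢` whose image under `(γ, γ₁) ↦ γ⁻¹ γ₁` is relatively compact. -/
def IsTube (A : Set 𝒢.RangePairs) : Prop := IsCompact (closure (𝒢.leftDiv '' A))

variable {𝒢} in
theorem IsTube.mono {A B : Set 𝒢.RangePairs} (hB : 𝒢.IsTube B) (h : A ⊆ B) : 𝒢.IsTube A :=
  hB.of_isClosed_subset isClosed_closure (closure_mono (image_mono h))

/-- The space `𝒞_t(𝒢 *_r 𝒢)` of bounded continuous functions on `𝒢 *_r 𝒢` with support in a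
tube. -/
def tubeKernels : Submodule ℂ (𝒢.RangePairs →ᵇ ℂ) where
  carrier := {f | 𝒢.IsTube (tsupport f)}
  zero_mem' := by simp [IsTube, tsupport]
  add_mem' := by
    intro f g hf hg
    have h : 𝒢.IsTube (tsupport f ∪ tsupport g) := by
      simpa [IsTube, image_union] using IsCompact.union hf hg
    exact h.mono (tsupport_add f g)
  smul_mem' := by
    intro c f hf
    refine IsTube.mono hf (closure_mono fun x hx h0 => hx ?_)
    simp [h0]

/-- The type of bounded continuous kernels on `𝒢 *_r 𝒢` with support in a tube. -/
def TubeKernel : Type _ := ↥𝒢.tubeKernels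

instance : AddCommGroup 𝒢.TubeKernel := inferInstanceAs (AddCommGroup ↥𝒢.tubeKernels)

instance : Module ℂ 𝒢.TubeKernel := inferInstanceAs (Module ℂ ↥𝒢.tubeKernels)

variable {𝒢} in
/-- The value of the kernel `k` at a pair of arrows with the same range. -/
def TubeKernel.app (k : 𝒢.TubeKernel) (γ γ₁ : G) (h : 𝒢.r γ = 𝒢.r γ₁) : ℂ := k.1 ⟨(γ, γ₁), h⟩

variable {𝒢} in
/-- The matrix `(k(γ, γ₁))` indexed by the fibre `𝒢ˣ`. -/
def TubeKernel.matrix (k : 𝒢.TubeKernel) (x : X) (γ γ₁ : 𝒢.Fiber x) : ℂ :=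
  k.app γ γ₁ (γ.2.trans γ₁.2.symm)

namespace TubeKernel

variable {𝒢} (k : 𝒢.TubeKernel)

/-- A compact set outside which `γ⁻¹ γ₁` forces `k(γ, γ₁) = 0`. -/
def tubeSet : Set G := closure (𝒢.leftDiv '' tsupport k.1)

theorem isCompact_tubeSet : IsCompact k.tubeSet := k.2

theorem mem_tubeSet (p : 𝒢.RangePairs) (h : k.1 p ≠ 0) : 𝒢.leftDiv p ∈ k.tubeSet :=
  subset_closure ⟨p, subset_tsupport _ h, rfl⟩

theorem exists_isBandMatrix : ∃ N : ℕ, ∀ x, IsBandMatrix (k.matrix x) ‖k.1‖ N := by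
  classical
  obtain ⟨N, hN⟩ := 𝒢.exists_card_bound k.isCompact_tubeSet
  obtain ⟨M, hM⟩ := 𝒢.exists_card_bound (k.isCompact_tubeSet.image 𝒢.continuous_inv)
  have aux : ∀ (x : X) (F : Finset G) (γ : 𝒢.Fiber x) (P : 𝒢.Fiber x → Prop),
      (∀ γ₁, P γ₁ → 𝒢.mul (𝒢.inv γ) γ₁ ∈ F) →
      ∃ F' : Finset (𝒢.Fiber x), F'.card ≤ F.card ∧ ∀ γ₁, P γ₁ → γ₁ ∈ F' := by
    intro x F γ P hP
    have hinj : Set.InjOn (fun γ₁ : 𝒢.Fiber x => 𝒢.mul (𝒢.inv γ) γ₁)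
        ((fun γ₁ : 𝒢.Fiber x => 𝒢.mul (𝒢.inv γ) γ₁) ⁻¹' F) := by
      intro a _ b _ hab
      have := congrArg (𝒢.mul γ) hab
      simp only at this
      rw [𝒢.inv_mul_cancel_left _ _ (γ.2.trans a.2.symm),
        𝒢.inv_mul_cancel_left _ _ (γ.2.trans b.2.symm)] at this
      exact Subtype.ext this
    refine ⟨F.preimage _ hinj, ?_, fun γ₁ h => Finset.mem_preimage.2 (hP γ₁ h)⟩
    exact Finset.card_le_card_of_injOn _ (fun a ha => Finset.mem_preimage.1 ha)
      (by simpa using hinj)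
  refine ⟨max N M, fun x => ⟨norm_nonneg _, fun γ γ₁ => k.1.norm_coe_le_norm _, fun γ => ?_,
    fun γ₁ => ?_⟩⟩
  · obtain ⟨F, hF, h⟩ := hN (𝒢.s γ)
    obtain ⟨F', hF', h'⟩ := aux x F γ (fun γ₁ => k.matrix x γ γ₁ ≠ 0) fun γ₁ h₁ =>
      h _ (k.mem_tubeSet _ h₁)
        (by rw [𝒢.r_mul _ _ ((𝒢.s_inv _).trans (γ.2.trans γ₁.2.symm)), 𝒢.r_inv])
    exact ⟨F', hF'.trans (hF.trans (le_max_left _ _)), h'⟩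
  · obtain ⟨F, hF, h⟩ := hM (𝒢.s γ₁)
    obtain ⟨F', hF', h'⟩ := aux x F γ₁ (fun γ => k.matrix x γ γ₁ ≠ 0) fun γ h₁ =>
      h _ ⟨_, k.mem_tubeSet _ h₁, 𝒢.inv_leftDiv _⟩
        (by rw [𝒢.r_mul _ _ ((𝒢.s_inv _).trans (γ₁.2.trans γ.2.symm)), 𝒢.r_inv])
    exact ⟨F', hF'.trans (hF.trans (le_max_right _ _)), h'⟩

/-- A uniform bound for the numbers of nonzero entries in rows and columns of the matrices of `k`. -/
def band : ℕ := k.exists_isBandMatrix.choose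

theorem isBandMatrix (x : X) : IsBandMatrix (k.matrix x) ‖k.1‖ k.band :=
  k.exists_isBandMatrix.choose_spec x

/-- The operator `(T(k) ξ)(γ) = ∑_{γ₁ ∈ 𝒢^{r(γ)}} k(γ, γ₁) ξ(γ₁)` on bounded sections. -/
def sectionsCLM : 𝒢.Sections →L[ℂ] 𝒢.Sections :=
  lp.mapCLM ∞ (fun x => (k.isBandMatrix x).toCLM) (mul_nonneg (Nat.cast_nonneg k.band) (norm_nonneg k.1))
    fun x => (k.isBandMatrix x).norm_toCLM_le

theorem sectionsCLM_apply (ξ : 𝒢.Sections) (x : X) (γ : 𝒢.Fiber x) :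
    k.sectionsCLM ξ x γ = ∑' γ₁ : 𝒢.Fiber x, k.matrix x γ γ₁ * ξ x γ₁ := rfl

end TubeKernel
end EtaleGroupoid

namespace EtaleGroupoid

variable {G X : Type*} [TopologicalSpace G] [TopologicalSpace X] {𝒢 : EtaleGroupoid G X}
  [T2Space G]

namespace TubeKernel

theorem mem_of_isCompact {f : 𝒢.RangePairs →ᵇ ℂ} {K : Set G} (hK : IsCompact K)
    (h : ∀ p, f p ≠ 0 → 𝒢.leftDiv p ∈ K) : f ∈ 𝒢.tubeKernels := by
  refine hK.of_isClosed_subset isClosed_closure (closure_minimal ?_ hK.isClosed)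
  rw [image_subset_iff]
  exact closure_minimal h (hK.isClosed.preimage 𝒢.continuous_leftDiv)

/-- The adjoint kernel `k⋆(γ, γ₁) = conj k(γ₁, γ)`. -/
def adjoint (k : 𝒢.TubeKernel) : 𝒢.TubeKernel :=
  ⟨star (k.1.compContinuous ⟨fun p => ⟨(p.1.2, p.1.1), p.2.symm⟩, by fun_prop⟩),
    mem_of_isCompact (k.isCompact_tubeSet.image 𝒢.continuous_inv) fun p hp => by
      have h : k.1 ⟨(p.1.2, p.1.1), p.2.symm⟩ ≠ 0 := fun h0 => hp (by simp [h0])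
      exact ⟨_, k.mem_tubeSet _ h, 𝒢.inv_leftDiv _⟩⟩

theorem matrix_adjoint (k : 𝒢.TubeKernel) (x : X) (γ γ₁ : 𝒢.Fiber x) :
    k.adjoint.matrix x γ γ₁ = star (k.matrix x γ₁ γ) := rfl

variable [T2Space X]

/-- The function `γ ↦ ∑_{γ₁ ∈ 𝒢^{r(γ)}} k(γ, γ₁) ξ(γ₁)` for `ξ ∈ C_c(𝒢)`. -/
def applyCc (k : 𝒢.TubeKernel) (ξ : C_c(G, ℂ)) : C_c(G, ℂ) where
  toFun γ := ∑' γ₁ : 𝒢.Fiber (𝒢.r γ), k.matrix (𝒢.r γ) ⟨γ, rfl⟩ γ₁ * ξ (γ₁ : G)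
  continuous_toFun := by
    classical
    let F : G → G → ℂ := fun γ γ₁ => if h : 𝒢.r γ = 𝒢.r γ₁ then k.app γ γ₁ h * ξ γ₁ else 0
    have hF : ContinuousOn (fun z : G × G => F z.1 z.2) {z | 𝒢.r z.1 = 𝒢.r z.2} := by
      rw [continuousOn_iff_continuous_domRestrict]
      have e : Set.domRestrict {z : G × G | 𝒢.r z.1 = 𝒢.r z.2} (fun z => F z.1 z.2)
          = fun p : 𝒢.RangePairs => k.1 p * ξ p.1.2 := by
        ext p
        have hp : 𝒢.r p.1.1 = 𝒢.r p.1.2 := p.2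
        simp [F, hp, TubeKernel.app]
      rw [e]
      have h1 := k.1.continuous
      have h2 := ξ.continuous
      fun_prop
    have h := 𝒢.continuous_fibreSum 𝒢.continuous_r hF ξ.hasCompactSupport (fun y γ hγ h => by
      refine subset_tsupport _ fun h0 => h ?_
      simp [F, hγ, h0])
    refine h.congr fun γ => tsum_congr fun γ₁ => ?_
    simp only [F, dif_pos γ₁.2.symm]
    rfl
  hasCompactSupport' := by
    set C : Set G := (fun z : G × G => 𝒢.mul z.1 z.2) ''
      ((tsupport ξ ×ˢ (𝒢.inv '' k.tubeSet)) ∩ {z | 𝒢.s z.1 = 𝒢.r z.2})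
    have hC : IsCompact C := by
      refine IsCompact.image_of_continuousOn ?_ (𝒢.continuousOn_mul.mono inter_subset_right)
      refine (ξ.hasCompactSupport.isCompact.prod
        (k.isCompact_tubeSet.image 𝒢.continuous_inv)).inter_right ?_
      have h1 := 𝒢.continuous_s
      have h2 := 𝒢.continuous_r
      exact isClosed_eq (by fun_prop) (by fun_prop)
    refine HasCompactSupport.intro hC fun γ hγ => ?_
    refine (tsum_congr fun γ₁ => ?_).trans tsum_zero
    by_contra hne
    have hk := left_ne_zero_of_mul hne
    have hξ := right_ne_zero_of_mul hne
    have hr : 𝒢.r γ = 𝒢.r (γ₁ : G) := γ₁.2.symm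
    refine hγ ⟨(γ₁, 𝒢.mul (𝒢.inv γ₁) γ), ⟨⟨subset_tsupport _ hξ, ?_⟩, ?_⟩, ?_⟩
    · exact ⟨_, k.mem_tubeSet ⟨(γ, γ₁), hr⟩ hk, 𝒢.inv_leftDiv _⟩
    · change 𝒢.s _ = 𝒢.r _
      rw [𝒢.r_mul _ _ ((𝒢.s_inv _).trans hr.symm), 𝒢.r_inv]
    · exact 𝒢.inv_mul_cancel_left _ _ hr.symm

theorem sectionsCLM_ofCc (k : 𝒢.TubeKernel) (ξ : C_c(G, ℂ)) :
    k.sectionsCLM (𝒢.ofCc ξ) = 𝒢.ofCc (k.applyCc ξ) := by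
  ext x γ
  obtain ⟨γ, rfl⟩ := γ
  rfl

/-- The operator `T(k)` on `ℰ`, as a bounded operator. -/
def opCLM (k : 𝒢.TubeKernel) : 𝒢.L2 →L[ℂ] 𝒢.L2 :=
  L2.restrictCLM k.sectionsCLM fun ξ => ⟨_, k.sectionsCLM_ofCc ξ⟩

theorem val_opCLM (k : 𝒢.TubeKernel) (ξ : 𝒢.L2) : L2.val (k.opCLM ξ) = k.sectionsCLM (L2.val ξ) :=
  rfl

/-- The adjointable operator `T(k) ∈ 𝓑(ℰ)` given by
`(T(k) ξ)(γ) = ∑_{γ₁ ∈ 𝒢^{r(γ)}} k(γ, γ₁) ξ(γ₁)`. -/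
def op (k : 𝒢.TubeKernel) : Adjointable C₀(X, ℂ) 𝒢.L2 :=
  Adjointable.mk k.opCLM k.adjoint.opCLM fun ξ η => by
    ext x
    exact (k.isBandMatrix x).inner_toCLM (L2.val ξ x) (L2.val η x)

theorem op_apply (k : 𝒢.TubeKernel) (ξ : 𝒢.L2) (γ : G) :
    L2.val (k.op.toCLM ξ) (𝒢.r γ) ⟨γ, rfl⟩ =
      ∑' γ₁ : 𝒢.Fiber (𝒢.r γ), k.app γ γ₁ γ₁.2.symm * L2.val ξ (𝒢.r γ) γ₁ := rfl

end TubeKernel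

variable (𝒢)

/-- The kernel `(γ, γ₁) ↦ f(γ⁻¹ γ₁)` in `𝒞_t(𝒢 *_r 𝒢)` associated with `f ∈ C_c(𝒢)`. -/
def ccKernel (f : C_c(G, ℂ)) : 𝒢.TubeKernel :=
  ⟨(f : G →ᵇ ℂ).compContinuous ⟨𝒢.leftDiv, 𝒢.continuous_leftDiv⟩,
    TubeKernel.mem_of_isCompact f.hasCompactSupport fun _ h => subset_tsupport _ h⟩

theorem ccKernel_app (f : C_c(G, ℂ)) (γ γ₁ : G) (h : 𝒢.r γ = 𝒢.r γ₁) :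
    (𝒢.ccKernel f).app γ γ₁ h = f (𝒢.mul (𝒢.inv γ) γ₁) := rfl

variable [T2Space X]

/-- The regular representation `Λ` of `C_c(𝒢)` in `ℰ`:
`(Λ(f) ξ)(γ) = ∑_{γ₁ ∈ 𝒢^{r(γ)}} f(γ⁻¹ γ₁) ξ(γ₁)`. -/
def regRep (f : C_c(G, ℂ)) : Adjointable C₀(X, ℂ) 𝒢.L2 := (𝒢.ccKernel f).op

theorem regRep_apply (f : C_c(G, ℂ)) (ξ : 𝒢.L2) (γ : G) :
    L2.val ((𝒢.regRep f).toCLM ξ) (𝒢.r γ) ⟨γ, rfl⟩ =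
      ∑' γ₁ : 𝒢.Fiber (𝒢.r γ), f (𝒢.mul (𝒢.inv γ) γ₁) * L2.val ξ (𝒢.r γ) γ₁ := rfl

/-- The reduced `C⋆`-algebra `C⋆_r(𝒢)`: the `C⋆`-subalgebra of `𝓑(ℰ)` generated by (equivalently,
the closure of) `Λ(C_c(𝒢))`. -/
def reducedCStar : NonUnitalStarSubalgebra ℂ (Adjointable C₀(X, ℂ) 𝒢.L2) :=
  (NonUnitalStarAlgebra.adjoin ℂ (range 𝒢.regRep)).topologicalClosure

/-- The uniform `C⋆`-algebra `C⋆_u(𝒢)`: the `C⋆`-subalgebra of `𝓑(ℰ)` generated by the operators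
`T(k)`, `k ∈ 𝒞_t(𝒢 *_r 𝒢)`. -/
def uniformCStar : NonUnitalStarSubalgebra ℂ (Adjointable C₀(X, ℂ) 𝒢.L2) :=
  (NonUnitalStarAlgebra.adjoin ℂ (range (TubeKernel.op (𝒢 := 𝒢)))).topologicalClosure

/-- `Λ(f)` as an element of `C⋆_r(𝒢)`. -/
def regRepReduced (f : C_c(G, ℂ)) : 𝒢.reducedCStar :=
  ⟨𝒢.regRep f, NonUnitalStarSubalgebra.le_topologicalClosure _
    (NonUnitalStarAlgebra.subset_adjoin ℂ _ (mem_range_self f))⟩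

/-- `T(k)` as an element of `C⋆_u(𝒢)`. -/
def opUniform (k : 𝒢.TubeKernel) : 𝒢.uniformCStar :=
  ⟨k.op, NonUnitalStarSubalgebra.le_topologicalClosure _
    (NonUnitalStarAlgebra.subset_adjoin ℂ _ (mem_range_self k))⟩

end EtaleGroupoid

/-! ## The fibrewise Stone–Čech compactification of the range map -/

namespace EtaleGroupoid

variable {G X : Type*} [TopologicalSpace G] [TopologicalSpace X] (𝒢 : EtaleGroupoid G X)

/-- The `C⋆`-algebra of the bounded continuous functions `f` on `𝒢` such that, for every `ε > 0`,
there is a compact set `K ⊆ X` with `|f(γ)| ≤ ε` for all `γ ∉ r⁻¹(K)`. -/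
def fibreC0 : NonUnitalStarSubalgebra ℂ (G →ᵇ ℂ) where
  carrier := {f | ∀ ε > 0, ∃ K : Set X, IsCompact K ∧ ∀ γ, 𝒢.r γ ∉ K → ‖f γ‖ ≤ ε}
  zero_mem' := fun ε hε => ⟨∅, isCompact_empty, fun γ _ => by simpa using hε.le⟩
  add_mem' := by
    intro f g hf hg ε hε
    obtain ⟨K, hK, h⟩ := hf (ε / 2) (half_pos hε)
    obtain ⟨L, hL, h'⟩ := hg (ε / 2) (half_pos hε)
    refine ⟨K ∪ L, hK.union hL, fun γ hγ => ?_⟩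
    rw [mem_union, not_or] at hγ
    exact (norm_add_le _ _).trans (by linarith [h γ hγ.1, h' γ hγ.2])
  mul_mem' := by
    intro f g hf _ ε hε
    obtain ⟨K, hK, h⟩ := hf (ε / (‖g‖ + 1)) (by positivity)
    refine ⟨K, hK, fun γ hγ => ?_⟩
    have h1 : ‖f γ‖ * ‖g γ‖ ≤ ε / (‖g‖ + 1) * (‖g‖ + 1) := by
      have h2 := g.norm_coe_le_norm γ
      have h3 := h γ hγ
      gcongr
      linarith
    rw [div_mul_cancel₀ _ (by positivity)] at h1
    simpa using h1
  smul_mem' := by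
    intro c f hf ε hε
    obtain ⟨K, hK, h⟩ := hf (ε / (‖c‖ + 1)) (by positivity)
    refine ⟨K, hK, fun γ hγ => ?_⟩
    have h1 : ‖f γ‖ * ‖c‖ ≤ ε / (‖c‖ + 1) * (‖c‖ + 1) := by
      have h3 := h γ hγ
      gcongr
      linarith
    rw [div_mul_cancel₀ _ (by positivity)] at h1
    change ‖c * f γ‖ ≤ ε
    rw [norm_mul]
    linarith
  star_mem' := by
    intro f hf ε hε
    obtain ⟨K, hK, h⟩ := hf ε hε
    exact ⟨K, hK, fun γ hγ => by simpa using h γ hγ⟩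

/-- The fibrewise Stone–Čech compactification `β_r𝒢` of `r : 𝒢 → X`: the Gelfand spectrum of the
commutative `C⋆`-algebra `fibreC0`, i.e. the space of its characters with the topology of pointwise
convergence. -/
abbrev BetaR : Type _ := WeakDual.characterSpace ℂ 𝒢.fibreC0

theorem mem_fibreC0_of_compact (f : G →ᵇ ℂ) {K : Set X} (hK : IsCompact K)
    (h : ∀ γ, 𝒢.r γ ∉ K → f γ = 0) : f ∈ 𝒢.fibreC0 :=
  fun ε hε => ⟨K, hK, fun γ hγ => by simpa [h γ hγ] using hε.le⟩

/-- The function `φ ∘ r` on `𝒢`, for `φ ∈ C₀(X)`. -/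
def pullC0 (φ : C₀(X, ℂ)) : 𝒢.fibreC0 :=
  ⟨φ.toBCF.compContinuous ⟨𝒢.r, 𝒢.continuous_r⟩, by
    intro ε hε
    have h := φ.zero_at_infty'.eventually (Metric.closedBall_mem_nhds (0 : ℂ) hε)
    obtain ⟨K, hK, h⟩ := mem_cocompact.1 h
    exact ⟨K, hK, fun γ hγ => by simpa using h hγ⟩⟩

theorem pullC0_apply (φ : C₀(X, ℂ)) (γ : G) : (𝒢.pullC0 φ).1 γ = φ (𝒢.r γ) := rfl

/-- The product of `f` with the bounded function `h ∘ r`. -/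
def modMul (h : X →ᵇ ℂ) (f : 𝒢.fibreC0) : 𝒢.fibreC0 :=
  ⟨h.compContinuous ⟨𝒢.r, 𝒢.continuous_r⟩ * f.1, by
    intro ε hε
    obtain ⟨K, hK, hf⟩ := f.2 (ε / (‖h‖ + 1)) (by positivity)
    refine ⟨K, hK, fun γ hγ => ?_⟩
    have h1 : ‖f.1 γ‖ * ‖h (𝒢.r γ)‖ ≤ ε / (‖h‖ + 1) * (‖h‖ + 1) := by
      have h2 := h.norm_coe_le_norm (𝒢.r γ)
      have h3 := hf γ hγ
      gcongr
      linarith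
    rw [div_mul_cancel₀ _ (by positivity)] at h1
    simpa [mul_comm] using h1⟩

theorem modMul_apply (h : X →ᵇ ℂ) (f : 𝒢.fibreC0) (γ : G) :
    (𝒢.modMul h f).1 γ = h (𝒢.r γ) * f.1 γ := rfl

variable {𝒢}

theorem fibreC0_ext {f g : 𝒢.fibreC0} (h : ∀ γ, f.1 γ = g.1 γ) : f = g :=
  Subtype.ext (BoundedContinuousFunction.ext h)

/-- Characters are contractive. -/
theorem BetaR.norm_le (z : 𝒢.BetaR) (f : 𝒢.fibreC0) : ‖z f‖ ≤ ‖f‖ := by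
  set T := WeakDual.CharacterSpace.toCLM z
  have h1 : ∀ f, ‖T f‖ ≤ √‖T‖ * ‖f‖ := by
    intro f
    have e : T f * T f = T (f * f) := (map_mul z f f).symm
    have h2 : ‖T f‖ * ‖T f‖ ≤ ‖T‖ * (‖f‖ * ‖f‖) := by
      rw [← norm_mul, e]
      exact (T.le_opNorm _).trans (by gcongr; exact norm_mul_le f f)
    refine abs_le_of_sq_le_sq' ?_ (by positivity) |>.2
    rw [mul_pow, Real.sq_sqrt (norm_nonneg T)]
    nlinarith
  have h2 : ‖T‖ ≤ √‖T‖ := T.opNorm_le_bound (Real.sqrt_nonneg _) h1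
  have h3 : √‖T‖ ≤ 1 := by
    have h4 := Real.mul_self_sqrt (norm_nonneg T)
    by_contra h
    nlinarith
  exact (h1 f).trans (mul_le_of_le_one_left (norm_nonneg f) h3)

theorem BetaR.exists_ne_zero (z : 𝒢.BetaR) : ∃ f, z f ≠ 0 := by
  by_contra! h
  exact z.2.1 (ContinuousLinearMap.ext h)

theorem norm_fibreC0_le {f : 𝒢.fibreC0} {C : ℝ} (hC : 0 ≤ C) (h : ∀ γ, ‖f.1 γ‖ ≤ C) : ‖f‖ ≤ C :=
  (BoundedContinuousFunction.norm_le hC).2 h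

theorem BetaR.norm_apply_le (z : 𝒢.BetaR) {f : 𝒢.fibreC0} {C : ℝ} (hC : 0 ≤ C)
    (h : ∀ γ, ‖f.1 γ‖ ≤ C) : ‖z f‖ ≤ C :=
  (z.norm_le f).trans (norm_fibreC0_le hC h)

theorem BetaR.modMul_mul (z : 𝒢.BetaR) (h : X →ᵇ ℂ) (f g : 𝒢.fibreC0) :
    z (𝒢.modMul h f) * z g = z (𝒢.modMul h g) * z f := by
  rw [← map_mul, ← map_mul]
  congr 1
  apply fibreC0_ext
  intro γ
  change h _ * f.1 γ * g.1 γ = h _ * g.1 γ * f.1 γ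
  ring

theorem BetaR.isCompact_le (f : 𝒢.fibreC0) {δ : ℝ} (hδ : 0 < δ) :
    IsCompact {z : 𝒢.BetaR | δ ≤ ‖z f‖} := by
  rw [Subtype.isCompact_iff]
  have hc : IsCompact (WeakDual.toStrongDual ⁻¹' Metric.closedBall (0 : StrongDual ℂ 𝒢.fibreC0) 1) :=
    WeakDual.isCompact_closedBall _ _
  have h1 : IsClosed {z : WeakDual ℂ 𝒢.fibreC0 | δ ≤ ‖z f‖} :=
    isClosed_le continuous_const (WeakDual.eval_continuous f).norm
  have h2 : IsClosed (WeakDual.characterSpace ℂ 𝒢.fibreC0 ∪ {0}) :=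
    WeakDual.CharacterSpace.union_zero_isClosed _ _
  refine (hc.inter_right (h1.inter h2)).of_isClosed_subset ?_ ?_
  · have : (Subtype.val '' {z : 𝒢.BetaR | δ ≤ ‖z f‖}) = {z : WeakDual ℂ 𝒢.fibreC0 | δ ≤ ‖z f‖} ∩
        (WeakDual.characterSpace ℂ 𝒢.fibreC0 ∪ {0}) := by
      ext w
      constructor
      · rintro ⟨z, hz, rfl⟩
        exact ⟨hz, Or.inl z.2⟩
      · rintro ⟨hw, hw' | hw'⟩
        · exact ⟨⟨w, hw'⟩, hw, rfl⟩
        · rw [mem_singleton_iff] at hw'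
          subst hw'
          have : δ ≤ ‖(0 : ℂ)‖ := hw
          rw [norm_zero] at this
          linarith
    rw [this]
    exact h1.inter h2
  · rintro w ⟨z, hz, rfl⟩
    refine ⟨?_, hz, Or.inl z.2⟩
    refine (mem_closedBall_zero_iff (E := StrongDual ℂ 𝒢.fibreC0)).2 ?_
    exact ContinuousLinearMap.opNorm_le_bound _ zero_le_one fun g => by
      rw [one_mul]
      exact BetaR.norm_le (𝒢 := 𝒢) z g

theorem BetaR.continuous_eval (f : 𝒢.fibreC0) : Continuous fun z : 𝒢.BetaR => z f :=
  (WeakDual.eval_continuous f).comp continuous_subtype_val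

theorem BetaR.continuous_of_eval {Y : Type*} [TopologicalSpace Y] {F : Y → 𝒢.BetaR}
    (h : ∀ f, Continuous fun y => F y f) : Continuous F :=
  Continuous.subtype_mk (WeakDual.continuous_of_continuous_eval h) _

instance : T2Space 𝒢.BetaR := by
  refine ⟨fun z w hzw => ?_⟩
  obtain ⟨f, hf⟩ : ∃ f, z f ≠ w f := by
    by_contra! h
    exact hzw (WeakDual.CharacterSpace.ext h)
  obtain ⟨U, V, hU, hV, hz, hw, hd⟩ := t2_separation hf
  exact ⟨_, _, hU.preimage (BetaR.continuous_eval f), hV.preimage (BetaR.continuous_eval f), hz, hw,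
    hd.preimage _⟩

instance : LocallyCompactSpace 𝒢.BetaR := by
  have : WeaklyLocallyCompactSpace 𝒢.BetaR := ⟨fun z => by
    obtain ⟨f, hf⟩ := z.exists_ne_zero
    have h0 : 0 < ‖z f‖ := norm_pos_iff.2 hf
    refine ⟨_, BetaR.isCompact_le f (half_pos h0), ?_⟩
    have h1 : IsOpen {w : 𝒢.BetaR | ‖z f‖ / 2 < ‖w f‖} :=
      isOpen_lt continuous_const (BetaR.continuous_eval f).norm
    exact Filter.mem_of_superset (h1.mem_nhds (half_lt_self h0)) fun w hw =>
      le_of_lt (show ‖z f‖ / 2 < ‖w f‖ from hw)⟩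
  infer_instance

theorem exists_modMul_pos (z : 𝒢.BetaR) (h : X →ᵇ ℂ) (hz : ∀ f, z (𝒢.modMul h f) = 0)
    (hh : ∀ x, 0 ≤ h x) {K : Set X} (hK : IsCompact K)
    (hpos : ∀ x ∈ K, h x ≠ 0) (f : 𝒢.fibreC0) {ε : ℝ} (hε : 0 ≤ ε) (hf : ∀ γ, 𝒢.r γ ∉ K → ‖f.1 γ‖ ≤ ε) :
    ‖z f‖ ≤ ε := by
  obtain ⟨δ, hδ, hδK⟩ : ∃ δ > 0, ∀ x ∈ K, δ ≤ (h x).re := by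
    rcases K.eq_empty_or_nonempty with rfl | hne
    · exact ⟨1, one_pos, by simp⟩
    · obtain ⟨x₀, hx₀, hm⟩ := hK.exists_isMinOn hne
        (f := fun x => (h x).re) (by fun_prop)
      refine ⟨(h x₀).re, ?_, fun x hx => hm hx⟩
      have h1 := Complex.le_def.1 (hh x₀)
      refine lt_of_le_of_ne h1.1 fun h2 => hpos x₀ hx₀ (Complex.ext h2.symm h1.2.symm)
  -- `u = 1 / max (h, δ)`
  let u : X →ᵇ ℂ := BoundedContinuousFunction.ofNormedAddCommGroup
    (fun x => (((max (h x).re δ)⁻¹ : ℝ) : ℂ))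
    (by
      have : ∀ x, max (h x).re δ ≠ 0 := fun x => (lt_max_of_lt_right hδ).ne'
      fun_prop (disch := assumption)) δ⁻¹ fun x => by
        have : 0 < max (h x).re δ := lt_max_of_lt_right hδ
        rw [Complex.norm_real, Real.norm_of_nonneg (by positivity)]
        exact inv_anti₀ hδ (le_max_right _ _)
  have h0 : z (𝒢.modMul h (𝒢.modMul u f)) = 0 := hz _
  have h1 : z f = z (f - 𝒢.modMul h (𝒢.modMul u f)) := by rw [map_sub, h0, sub_zero]
  rw [h1]
  refine z.norm_apply_le hε fun γ => ?_
  change ‖f.1 γ - h (𝒢.r γ) * ((((max (h (𝒢.r γ)).re δ)⁻¹ : ℝ) : ℂ) * f.1 γ)‖ ≤ ε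
  set x := 𝒢.r γ with hx
  have hre : h x = ((h x).re : ℂ) := Complex.eq_re_of_ofReal_le (hh x)
  have hm : 0 < max (h x).re δ := lt_max_of_lt_right hδ
  have h2 : f.1 γ - h x * ((((max (h x).re δ)⁻¹ : ℝ) : ℂ) * f.1 γ) =
      ((1 - (h x).re * (max (h x).re δ)⁻¹ : ℝ) : ℂ) * f.1 γ := by
    rw [hre]
    push_cast
    simp only [Complex.ofReal_re]
    ring
  rw [h2, norm_mul, Complex.norm_real]
  by_cases hxK : x ∈ K
  · rw [max_eq_left (hδK x hxK), mul_inv_cancel₀ (hδ.trans_le (hδK x hxK)).ne']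
    simpa using hε
  · have h3 : 0 ≤ (h x).re * (max (h x).re δ)⁻¹ :=
      mul_nonneg (Complex.le_def.1 (hh x)).1 (by positivity)
    have h4 : (h x).re * (max (h x).re δ)⁻¹ ≤ 1 := by
      rw [← div_eq_mul_inv, div_le_one hm]
      exact le_max_left _ _
    rw [Real.norm_of_nonneg (by linarith)]
    exact (mul_le_of_le_one_left (norm_nonneg _) (by linarith)).trans (hf γ hxK)

theorem BetaR.exists_q (z : 𝒢.BetaR) : ∃ x : X, ∀ φ : C₀(X, ℂ), z (𝒢.pullC0 φ) = φ x := by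
  classical
  by_contra! hcon
  choose φ hφ using hcon
  obtain ⟨f₀, hf₀⟩ := z.exists_ne_zero
  obtain ⟨K, hK, hfK⟩ := f₀.2 (‖z f₀‖ / 2) (by positivity)
  -- the function `|φ_x - z(φ_x ∘ r)|²`
  let w : X → (X →ᵇ ℂ) := fun x => (φ x).toBCF - BoundedContinuousFunction.const X (z (𝒢.pullC0 (φ x)))
  have hw : ∀ x f, z (𝒢.modMul (w x) f) = 0 := by
    intro x f
    have : 𝒢.modMul (w x) f = 𝒢.pullC0 (φ x) * f - z (𝒢.pullC0 (φ x)) • f := by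
      apply fibreC0_ext
      intro γ
      change (φ x (𝒢.r γ) - z (𝒢.pullC0 (φ x))) * f.1 γ =
        φ x (𝒢.r γ) * f.1 γ - z (𝒢.pullC0 (φ x)) * f.1 γ
      ring
    rw [this, map_sub, map_mul, map_smul, smul_eq_mul, sub_self]
  have hnhds : ∀ x, {y | w x y ≠ 0} ∈ 𝓝 x := by
    intro x
    have : IsOpen {y | w x y ≠ 0} := isOpen_ne_fun (w x).continuous continuous_const
    exact this.mem_nhds (sub_ne_zero.2 (hφ x).symm)
  obtain ⟨t, -, ht⟩ := hK.elim_nhds_subcover _ fun x _ => hnhds x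
  let h : X →ᵇ ℂ := ∑ x ∈ t, star (w x) * w x
  have happ : ∀ y, h y = ∑ x ∈ t, star (w x y) * w x y := fun y => by
    simp [h]
  have hterm : ∀ x y, 0 ≤ star (w x y) * w x y := fun x y => star_mul_self_nonneg _
  have key := exists_modMul_pos z h (fun f => ?_) (fun y => ?_) hK (fun y hy => ?_) f₀
    (by positivity) hfK
  · have : 0 < ‖z f₀‖ := norm_pos_iff.2 hf₀
    linarith
  · have : 𝒢.modMul h f = ∑ x ∈ t, 𝒢.modMul (w x) (𝒢.modMul (star (w x)) f) := by
      apply fibreC0_ext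
      intro γ
      have e : (∑ x ∈ t, 𝒢.modMul (w x) (𝒢.modMul (star (w x)) f)).1 γ =
          ∑ x ∈ t, (𝒢.modMul (w x) (𝒢.modMul (star (w x)) f)).1 γ := by
        simp
      rw [e, modMul_apply, happ, Finset.sum_mul]
      refine Finset.sum_congr rfl fun x _ => ?_
      rw [modMul_apply, modMul_apply]
      change _ = w x _ * (star (w x _) * _)
      ring
    rw [this, map_sum]
    exact Finset.sum_eq_zero fun x _ => hw x _
  · rw [happ]
    exact Finset.sum_nonneg fun x _ => hterm x y
  · rw [happ]
    intro h0
    obtain ⟨x, hx, hxy⟩ := mem_iUnion₂.1 (ht hy)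
    have := (Finset.sum_eq_zero_iff_of_nonneg fun x _ => hterm x y).1 h0 x hx
    rcases mul_eq_zero.1 this with h1 | h1
    · exact hxy (star_eq_zero.1 h1)
    · exact hxy h1

/-- The canonical map `q : β_r𝒢 → X` extending `r`: the point `q(z)` is characterized by
`z(φ ∘ r) = φ(q(z))` for all `φ ∈ C₀(X)`. -/
def BetaR.q (z : 𝒢.BetaR) : X := z.exists_q.choose

theorem BetaR.apply_pullC0 (z : 𝒢.BetaR) (φ : C₀(X, ℂ)) : z (𝒢.pullC0 φ) = φ z.q :=
  z.exists_q.choose_spec φ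

section LocallyCompact

variable [T2Space X] [LocallyCompactSpace X]

/-- Bump functions on `X`. -/
theorem exists_bump (x : X) {V : Set X} (hV : V ∈ 𝓝 x) :
    ∃ ψ : X →ᵇ ℂ, (∀ᶠ y in 𝓝 x, ψ y = 1) ∧ HasCompactSupport ψ ∧ tsupport ψ ⊆ V ∧
      ∀ y, ‖ψ y‖ ≤ 1 := by
  obtain ⟨L, hL, hLV, hLc⟩ := local_compact_nhds (isOpen_interior.mem_nhds (mem_interior_iff_mem_nhds.2 hV))
  obtain ⟨ψ, h1, h2, h3, h4⟩ := exists_continuousMap_one_of_isCompact_subset_isOpen hLc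
    (isOpen_interior (s := V)) hLV
  have e : tsupport (fun y => (ψ y : ℂ)) = tsupport ψ := by
    simp only [tsupport]
    congr 1
    ext y
    simp
  refine ⟨BoundedContinuousFunction.ofNormedAddCommGroup (fun y => (ψ y : ℂ)) (by fun_prop) 1
    fun y => ?_, ?_, ?_, ?_, fun y => ?_⟩
  · rw [Complex.norm_real, Real.norm_of_nonneg (h4 y).1]
    exact (h4 y).2
  · filter_upwards [hL] with y hy
    simpa using h1 hy
  · change IsCompact (tsupport fun y => (ψ y : ℂ))
    rwa [e]
  · change tsupport (fun y => (ψ y : ℂ)) ⊆ V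
    rw [e]
    exact h3.trans interior_subset
  · change ‖(ψ y : ℂ)‖ ≤ 1
    rw [Complex.norm_real, Real.norm_of_nonneg (h4 y).1]
    exact (h4 y).2

/-- A compactly supported bounded continuous function as an element of `C₀(X)`. -/
def c0OfCompact (ψ : X →ᵇ ℂ) (h : HasCompactSupport ψ) : C₀(X, ℂ) :=
  ⟨⟨ψ, ψ.continuous⟩, h.is_zero_at_infty⟩

theorem BetaR.q_eq_of {z : 𝒢.BetaR} {x : X} (h : ∀ φ : C₀(X, ℂ), z (𝒢.pullC0 φ) = φ x) :
    z.q = x := by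
  by_contra hne
  obtain ⟨ψ, h1, h2, h3, -⟩ := exists_bump z.q (isOpen_compl_singleton.mem_nhds hne)
  have h4 := h (c0OfCompact ψ h2)
  rw [z.apply_pullC0] at h4
  change ψ _ = ψ _ at h4
  rw [h1.self_of_nhds] at h4
  exact h3 (subset_tsupport _ (show ψ x ≠ 0 by rw [← h4]; exact one_ne_zero)) rfl

theorem BetaR.continuous_q : Continuous (BetaR.q (𝒢 := 𝒢)) := by
  rw [continuous_iff_continuousAt]
  intro z V hV
  obtain ⟨ψ, h1, h2, h3, -⟩ := exists_bump z.q hV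
  have h4 : IsOpen {w : 𝒢.BetaR | w (𝒢.pullC0 (c0OfCompact ψ h2)) ≠ 0} :=
    isOpen_ne_fun (BetaR.continuous_eval _) continuous_const
  refine mem_map.2 (Filter.mem_of_superset (h4.mem_nhds (x := z) ?_) fun w hw => h3 (subset_tsupport _ ?_))
  · change z _ ≠ 0
    rw [z.apply_pullC0]
    change ψ _ ≠ 0
    rw [h1.self_of_nhds]
    exact one_ne_zero
  · change w _ ≠ 0 at hw
    rwa [w.apply_pullC0] at hw

theorem BetaR.isCompact_preimage_q {K : Set X} (hK : IsCompact K) :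
    IsCompact (BetaR.q (𝒢 := 𝒢) ⁻¹' K) := by
  obtain ⟨ψ, h1, h2, -, h4⟩ := exists_continuousMap_one_of_isCompact_subset_isOpen hK isOpen_univ
    (subset_univ K)
  let φ : C₀(X, ℂ) := ⟨⟨fun x => (ψ x : ℂ), by fun_prop⟩, HasCompactSupport.is_zero_at_infty (by
    have e : tsupport (fun y => (ψ y : ℂ)) = tsupport ψ := by
      simp only [tsupport]
      congr 1
      ext y
      simp
    change IsCompact (tsupport fun y => (ψ y : ℂ))
    rwa [e])⟩
  refine (BetaR.isCompact_le (𝒢.pullC0 φ) one_pos).of_isClosed_subset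
    (hK.isClosed.preimage BetaR.continuous_q) fun z hz => ?_
  change 1 ≤ ‖z _‖
  rw [z.apply_pullC0]
  change 1 ≤ ‖(ψ z.q : ℂ)‖
  rw [h1 hz]
  simp

/-- A character only depends on the restrictions of functions near the fibre over `q(z)`. -/
theorem BetaR.eq_of_germ (z : 𝒢.BetaR) (k : 𝒢.fibreC0) (c : ℂ)
    (h : ∀ ε > 0, ∀ᶠ x in 𝓝 z.q, ∀ η, 𝒢.r η = x → ‖k.1 η - c‖ ≤ ε) : z k = c := by
  refine eq_of_forall_dist_le fun ε hε => ?_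
  obtain ⟨ψ, h1, h2, h3, h4⟩ := exists_bump z.q (h ε hε)
  set p := 𝒢.pullC0 (c0OfCompact ψ h2)
  have hp : z p = 1 := by
    rw [z.apply_pullC0]
    exact h1.self_of_nhds
  have e : z k - c = z (k * p - c • p) := by
    rw [map_sub, map_mul, map_smul, hp, smul_eq_mul, mul_one, mul_one]
  rw [dist_eq_norm, e]
  refine z.norm_apply_le hε.le fun η => ?_
  change ‖k.1 η * ψ (𝒢.r η) - c * ψ (𝒢.r η)‖ ≤ ε
  rw [← sub_mul, norm_mul]
  by_cases h0 : ψ (𝒢.r η) = 0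
  · simpa [h0] using hε.le
  · exact (mul_le_of_le_one_right (norm_nonneg _) (h4 _)).trans
      (h3 (subset_tsupport _ h0) η rfl)

theorem BetaR.eq_of_germ_eq (z : 𝒢.BetaR) (k l : 𝒢.fibreC0)
    (h : ∀ᶠ x in 𝓝 z.q, ∀ η, 𝒢.r η = x → k.1 η = l.1 η) : z k = z l := by
  have h1 := z.eq_of_germ (k - l) 0 fun ε hε => by
    filter_upwards [h] with x hx η hη
    change ‖k.1 η - l.1 η - 0‖ ≤ ε
    simpa [hx η hη] using hε.le
  rwa [map_sub, sub_eq_zero] at h1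

/-- The canonical map `i : 𝒢 → β_r𝒢`, sending `γ` to the evaluation at `γ`. -/
def toBeta (γ : G) : 𝒢.BetaR :=
  ⟨ContinuousLinearMap.mk
    { toFun := fun f => f.1 γ
      map_add' := fun _ _ => rfl
      map_smul' := fun _ _ => rfl }
    ((BoundedContinuousFunction.evalCLM ℂ γ).continuous.comp continuous_subtype_val), by
    refine ⟨fun h => ?_, fun f g => rfl⟩
    obtain ⟨ψ, h1, h2, -⟩ := exists_bump (𝒢.r γ) Filter.univ_mem
    have h3 := congrArg (fun T : WeakDual ℂ 𝒢.fibreC0 => T (𝒢.pullC0 (c0OfCompact ψ h2))) h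
    change ψ (𝒢.r γ) = 0 at h3
    rw [h1.self_of_nhds] at h3
    exact one_ne_zero h3⟩

theorem toBeta_apply (γ : G) (f : 𝒢.fibreC0) : (toBeta γ : 𝒢.BetaR) f = f.1 γ := rfl

theorem continuous_toBeta : Continuous (toBeta (𝒢 := 𝒢)) :=
  BetaR.continuous_of_eval fun f => f.1.continuous

theorem q_toBeta (γ : G) : (toBeta γ : 𝒢.BetaR).q = 𝒢.r γ := BetaR.q_eq_of fun _ => rfl

theorem BetaR.surjective_q : Function.Surjective (BetaR.q (𝒢 := 𝒢)) := fun x =>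
  ⟨toBeta (𝒢.e x), (q_toBeta _).trans (𝒢.r_e x)⟩

end LocallyCompact

end EtaleGroupoid

/-! ## Actions of étale groupoids, the action of `𝒢` on `β_r𝒢` -/

namespace EtaleGroupoid

variable {G X : Type*} [TopologicalSpace G] [TopologicalSpace X] (𝒢 : EtaleGroupoid G X)

/-- An action of `𝒢` on the space `Y` over `X`, i.e. the structure of a `𝒢`-space on `Y`, with
anchor map `p : Y → X`. The point `act γ y = γ y` is meaningful only if `s γ = p y`. -/
structure GSpace (Y : Type*) [TopologicalSpace Y] where
  /-- the anchor map -/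
  p : Y → X
  /-- the action, relevant on pairs `(γ, y)` with `s γ = p y` only -/
  act : G → Y → Y
  continuous_p : Continuous p
  surjective_p : Function.Surjective p
  p_act : ∀ γ y, 𝒢.s γ = p y → p (act γ y) = 𝒢.r γ
  e_act : ∀ y, act (𝒢.e (p y)) y = y
  mul_act : ∀ γ₂ γ₁ y, 𝒢.s γ₂ = 𝒢.r γ₁ → 𝒢.s γ₁ = p y → act (𝒢.mul γ₂ γ₁) y = act γ₂ (act γ₁ y)
  continuousOn_act : ContinuousOn (fun z : G × Y => act z.1 z.2) {z | 𝒢.s z.1 = p z.2}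

/-- The domain of the local section `sec γ` of the source map. -/
def secDom (γ : G) : Set X := (𝒢.isLocalHomeomorph_r.localInverseAt (𝒢.inv γ)).source

/-- A continuous local section of the source map through `γ`, defined on `secDom γ`. -/
def sec (γ : G) (x : X) : G := 𝒢.inv (𝒢.isLocalHomeomorph_r.localInverseAt (𝒢.inv γ) x)

theorem isOpen_secDom (γ : G) : IsOpen (𝒢.secDom γ) := OpenPartialHomeomorph.open_source _

theorem s_mem_secDom (γ : G) : 𝒢.s γ ∈ 𝒢.secDom γ := by
  rw [← 𝒢.r_inv]
  exact IsLocalHomeomorph.apply_self_mem_localInverseAt_source ..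

theorem secDom_mem_nhds (γ : G) : 𝒢.secDom γ ∈ 𝓝 (𝒢.s γ) :=
  (𝒢.isOpen_secDom γ).mem_nhds (𝒢.s_mem_secDom γ)

theorem s_sec (γ : G) {x : X} (hx : x ∈ 𝒢.secDom γ) : 𝒢.s (𝒢.sec γ x) = x :=
  (𝒢.s_inv _).trans (IsLocalHomeomorph.apply_localInverseAt_of_mem _ hx)

theorem sec_self (γ : G) : 𝒢.sec γ (𝒢.s γ) = γ := by
  rw [sec, ← 𝒢.r_inv, IsLocalHomeomorph.localInverseAt_apply_self, 𝒢.inv_inv]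

theorem continuousOn_sec (γ : G) : ContinuousOn (𝒢.sec γ) (𝒢.secDom γ) :=
  𝒢.continuous_inv.comp_continuousOn (OpenPartialHomeomorph.continuousOn _)

theorem continuousAt_sec (γ : G) : ContinuousAt (𝒢.sec γ) (𝒢.s γ) :=
  (𝒢.continuousOn_sec γ).continuousAt (𝒢.secDom_mem_nhds γ)

theorem eventually_sec_eq (γ : G) : ∀ᶠ γ' in 𝓝 γ, 𝒢.sec γ (𝒢.s γ') = γ' := by
  have h : ContinuousAt 𝒢.inv γ := 𝒢.continuous_inv.continuousAt
  filter_upwards [h.eventually ((OpenPartialHomeomorph.open_target _).mem_nhds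
    (𝒢.isLocalHomeomorph_r.self_mem_localInverseAt_target (x := 𝒢.inv γ)))] with γ' hγ'
  have h1 := (𝒢.isLocalHomeomorph_r.localInverseAt (𝒢.inv γ)).right_inv hγ'
  rw [IsLocalHomeomorph.localInverseAt_symm, 𝒢.r_inv] at h1
  rw [sec, h1, 𝒢.inv_inv]

theorem eventually_eq_sec {γ : G} {τ : X → G} (h1 : ∀ᶠ x in 𝓝 (𝒢.s γ), 𝒢.s (τ x) = x)
    (h2 : ContinuousAt τ (𝒢.s γ)) (h3 : τ (𝒢.s γ) = γ) :
    ∀ᶠ x in 𝓝 (𝒢.s γ), 𝒢.sec γ x = τ x := by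
  have h4 : ∀ᶠ γ' in 𝓝 (τ (𝒢.s γ)), 𝒢.sec γ (𝒢.s γ') = γ' := by
    rw [h3]
    exact 𝒢.eventually_sec_eq γ
  filter_upwards [h1, h2.eventually h4] with x hx hx'
  rwa [hx] at hx'

section LocallyCompact

variable [T2Space X] [LocallyCompactSpace X]

/-- A cut-off function near `s γ` with support in `secDom γ`. -/
def cutoff (γ : G) : X →ᵇ ℂ := (exists_bump (𝒢.s γ) (𝒢.secDom_mem_nhds γ)).choose

theorem cutoff_spec (γ : G) : (∀ᶠ y in 𝓝 (𝒢.s γ), 𝒢.cutoff γ y = 1) ∧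
    HasCompactSupport (𝒢.cutoff γ) ∧ tsupport (𝒢.cutoff γ) ⊆ 𝒢.secDom γ ∧
      ∀ y, ‖𝒢.cutoff γ y‖ ≤ 1 :=
  (exists_bump (𝒢.s γ) (𝒢.secDom_mem_nhds γ)).choose_spec

/-- Left translation of functions: near the fibre over `s γ`, `transl γ f` is the function
`η ↦ f(τ(r(η)) η)`, where `τ` is the local section of `s` through `γ`. -/
def transl (γ : G) (f : 𝒢.fibreC0) : 𝒢.fibreC0 :=
  ⟨BoundedContinuousFunction.ofNormedAddCommGroup
    (fun η => 𝒢.cutoff γ (𝒢.r η) * f.1 (𝒢.mul (𝒢.sec γ (𝒢.r η)) η))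
    (by
      obtain ⟨-, -, h3, -⟩ := 𝒢.cutoff_spec γ
      rw [continuous_iff_continuousAt]
      intro η
      by_cases hη : 𝒢.r η ∈ 𝒢.secDom γ
      · have hD : IsOpen (𝒢.r ⁻¹' 𝒢.secDom γ) := (𝒢.isOpen_secDom γ).preimage 𝒢.continuous_r
        refine ContinuousOn.continuousAt (s := 𝒢.r ⁻¹' 𝒢.secDom γ) ?_ (hD.mem_nhds hη)
        refine ((𝒢.cutoff γ).continuous.comp 𝒢.continuous_r).continuousOn.mul ?_
        refine f.1.continuous.comp_continuousOn ?_
        refine 𝒢.continuousOn_mul.comp (f := fun η => (𝒢.sec γ (𝒢.r η), η)) ?_ fun η hη => 𝒢.s_sec γ hη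
        exact ((𝒢.continuousOn_sec γ).comp 𝒢.continuous_r.continuousOn fun _ h => h).prodMk
          continuousOn_id
      · have hO : IsOpen (𝒢.r ⁻¹' (tsupport (𝒢.cutoff γ))ᶜ) :=
          (isClosed_tsupport _).isOpen_compl.preimage 𝒢.continuous_r
        refine (continuousAt_const (y := (0 : ℂ))).congr ?_
        filter_upwards [hO.mem_nhds fun h => hη (h3 h)] with η' hη'
        rw [image_eq_zero_of_notMem_tsupport hη', zero_mul])
    ‖f.1‖ fun η => by
      rw [norm_mul]
      exact (mul_le_of_le_one_left (norm_nonneg _) ((𝒢.cutoff_spec γ).2.2.2 _)).trans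
        (f.1.norm_coe_le_norm _),
    𝒢.mem_fibreC0_of_compact _ (𝒢.cutoff_spec γ).2.1 fun η hη => by
      change 𝒢.cutoff γ (𝒢.r η) * f.1 (𝒢.mul (𝒢.sec γ (𝒢.r η)) η) = 0
      rw [image_eq_zero_of_notMem_tsupport hη, zero_mul]⟩

theorem transl_apply (γ : G) (f : 𝒢.fibreC0) (η : G) :
    (𝒢.transl γ f).1 η = 𝒢.cutoff γ (𝒢.r η) * f.1 (𝒢.mul (𝒢.sec γ (𝒢.r η)) η) := rfl

theorem norm_transl_le (γ : G) (f : 𝒢.fibreC0) : ‖𝒢.transl γ f‖ ≤ ‖f‖ :=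
  norm_fibreC0_le (norm_nonneg f) fun η => by
    rw [transl_apply, norm_mul]
    exact (mul_le_of_le_one_left (norm_nonneg _) ((𝒢.cutoff_spec γ).2.2.2 _)).trans
      (f.1.norm_coe_le_norm _)

theorem eventually_transl (γ : G) (f : 𝒢.fibreC0) : ∀ᶠ x in 𝓝 (𝒢.s γ), ∀ η, 𝒢.r η = x →
    (𝒢.transl γ f).1 η = f.1 (𝒢.mul (𝒢.sec γ x) η) := by
  filter_upwards [(𝒢.cutoff_spec γ).1] with x hx η hη
  rw [transl_apply, hη, hx, one_mul]

/-- The character `f ↦ z(transl γ f)` for `z` in the fibre over `s γ`. -/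
def actAux (γ : G) (z : 𝒢.BetaR) (hz : z.q = 𝒢.s γ) : 𝒢.BetaR :=
  ⟨LinearMap.mkContinuous
    { toFun := fun f => z (𝒢.transl γ f)
      map_add' := fun f g => by
        rw [← map_add]
        congr 1
        apply fibreC0_ext
        intro η
        exact mul_add (𝒢.cutoff γ (𝒢.r η)) _ _
      map_smul' := fun c f => by
        rw [← map_smul]
        congr 1
        apply fibreC0_ext
        intro η
        exact mul_left_comm (𝒢.cutoff γ (𝒢.r η)) c _ } 1 fun f => by
      rw [one_mul]
      exact (BetaR.norm_le z _).trans (𝒢.norm_transl_le γ f), by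
    refine ⟨fun h => ?_, fun f g => ?_⟩
    · obtain ⟨ψ, h1, h2, -⟩ := exists_bump (𝒢.r γ) Filter.univ_mem
      have h3 := congrArg (fun T : WeakDual ℂ 𝒢.fibreC0 => T (𝒢.pullC0 (c0OfCompact ψ h2))) h
      change z (𝒢.transl γ _) = 0 at h3
      have h4 : z (𝒢.transl γ (𝒢.pullC0 (c0OfCompact ψ h2))) = 1 := by
        refine BetaR.eq_of_germ z _ _ fun ε hε => ?_
        rw [hz]
        have h5 : ContinuousAt (fun x => 𝒢.r (𝒢.sec γ x)) (𝒢.s γ) :=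
          𝒢.continuous_r.continuousAt.comp (𝒢.continuousAt_sec γ)
        have h6 : ∀ᶠ y in 𝓝 (𝒢.r (𝒢.sec γ (𝒢.s γ))), ψ y = 1 := by rwa [𝒢.sec_self]
        filter_upwards [𝒢.eventually_transl γ (𝒢.pullC0 (c0OfCompact ψ h2)), h5.eventually h6,
          𝒢.secDom_mem_nhds γ] with x hx hx' hx'' η hη
        rw [hx η hη, pullC0_apply, 𝒢.r_mul _ _ ((𝒢.s_sec γ hx'').trans hη.symm)]
        change ‖ψ _ - 1‖ ≤ ε
        rw [hx']
        simpa using hε.le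
      rw [h4] at h3
      exact one_ne_zero h3
    · change z (𝒢.transl γ (f * g)) = z (𝒢.transl γ f) * z (𝒢.transl γ g)
      rw [← map_mul]
      refine BetaR.eq_of_germ_eq z _ _ ?_
      rw [hz]
      filter_upwards [𝒢.eventually_transl γ f, 𝒢.eventually_transl γ g,
        𝒢.eventually_transl γ (f * g)] with x h1 h2 h3 η hη
      rw [h3 η hη]
      change f.1 _ * g.1 _ = (𝒢.transl γ f).1 η * (𝒢.transl γ g).1 η
      rw [h1 η hη, h2 η hη]⟩

open Classical in
/-- The action of `𝒢` on `β_r𝒢` extending the left action of `𝒢` on itself: for `q(z) = s(γ)`, the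
character `γ z` maps `f` to `z(k)`, where `k` is any function with `k(η) = f(τ(r(η)) η)` near the
fibre over `s(γ)` and `τ` is the local section of `s` through `γ`. -/
def betaAct (γ : G) (z : 𝒢.BetaR) : 𝒢.BetaR := if hz : z.q = 𝒢.s γ then 𝒢.actAux γ z hz else z

theorem betaAct_apply {γ : G} {z : 𝒢.BetaR} (hz : z.q = 𝒢.s γ) (f : 𝒢.fibreC0) :
    𝒢.betaAct γ z f = z (𝒢.transl γ f) := by
  rw [betaAct, dif_pos hz]
  rfl

theorem betaAct_apply_of_eventually {γ : G} {z : 𝒢.BetaR} (hz : z.q = 𝒢.s γ) {τ : X → G}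
    (h1 : ∀ᶠ x in 𝓝 (𝒢.s γ), 𝒢.s (τ x) = x) (h2 : ContinuousAt τ (𝒢.s γ)) (h3 : τ (𝒢.s γ) = γ)
    (f k : 𝒢.fibreC0)
    (hk : ∀ᶠ x in 𝓝 (𝒢.s γ), ∀ η, 𝒢.r η = x → k.1 η = f.1 (𝒢.mul (τ x) η)) :
    𝒢.betaAct γ z f = z k := by
  rw [𝒢.betaAct_apply hz]
  refine BetaR.eq_of_germ_eq z _ _ ?_
  rw [hz]
  filter_upwards [hk, 𝒢.eventually_transl γ f, 𝒢.eventually_eq_sec h1 h2 h3] with x hx hx' hx'' η hη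
  rw [hx η hη, hx' η hη, hx'']

/-- On the points of `𝒢` the action is given by left multiplication. -/
theorem betaAct_toBeta (γ η : G) (h : 𝒢.s γ = 𝒢.r η) :
    𝒢.betaAct γ (toBeta η) = toBeta (𝒢.mul γ η) := by
  apply WeakDual.CharacterSpace.ext
  intro f
  rw [𝒢.betaAct_apply ((q_toBeta η).trans h.symm), toBeta_apply, toBeta_apply,
    (𝒢.eventually_transl γ f).self_of_nhds η h.symm, 𝒢.sec_self]

theorem q_betaAct (γ : G) (z : 𝒢.BetaR) (hz : 𝒢.s γ = z.q) : (𝒢.betaAct γ z).q = 𝒢.r γ := by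
  refine BetaR.q_eq_of fun φ => ?_
  rw [𝒢.betaAct_apply hz.symm]
  refine BetaR.eq_of_germ z _ _ fun ε hε => ?_
  rw [← hz]
  have h5 : ContinuousAt (fun x => φ (𝒢.r (𝒢.sec γ x))) (𝒢.s γ) :=
    φ.continuous.continuousAt.comp (𝒢.continuous_r.continuousAt.comp (𝒢.continuousAt_sec γ))
  have h6 := h5.eventually (Metric.closedBall_mem_nhds _ hε)
  filter_upwards [𝒢.eventually_transl γ (𝒢.pullC0 φ), h6, 𝒢.secDom_mem_nhds γ] with x hx hx' hx'' η hη
  rw [hx η hη, pullC0_apply, 𝒢.r_mul _ _ ((𝒢.s_sec γ hx'').trans hη.symm)]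
  rwa [𝒢.sec_self, dist_eq_norm] at hx'

theorem e_betaAct (z : 𝒢.BetaR) : 𝒢.betaAct (𝒢.e z.q) z = z := by
  apply WeakDual.CharacterSpace.ext
  intro f
  refine 𝒢.betaAct_apply_of_eventually (𝒢.s_e _).symm (τ := 𝒢.e) (Eventually.of_forall 𝒢.s_e)
    𝒢.continuous_e.continuousAt (by rw [𝒢.s_e]) f f (Eventually.of_forall fun x η hη => ?_)
  rw [← hη, 𝒢.e_mul]

theorem mul_betaAct (γ₂ γ₁ : G) (z : 𝒢.BetaR) (h : 𝒢.s γ₂ = 𝒢.r γ₁) (hz : 𝒢.s γ₁ = z.q) :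
    𝒢.betaAct (𝒢.mul γ₂ γ₁) z = 𝒢.betaAct γ₂ (𝒢.betaAct γ₁ z) := by
  apply WeakDual.CharacterSpace.ext
  intro f
  rw [𝒢.betaAct_apply ((𝒢.q_betaAct γ₁ z hz).trans h.symm), 𝒢.betaAct_apply hz.symm]
  have hs := 𝒢.s_mul _ _ h
  have hr : ContinuousAt (fun x => 𝒢.r (𝒢.sec γ₁ x)) (𝒢.s γ₁) :=
    𝒢.continuous_r.continuousAt.comp (𝒢.continuousAt_sec γ₁)
  have hr0 : 𝒢.r (𝒢.sec γ₁ (𝒢.s γ₁)) = 𝒢.s γ₂ := by rw [𝒢.sec_self, h]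
  have hD : ∀ᶠ x in 𝓝 (𝒢.s γ₁), 𝒢.r (𝒢.sec γ₁ x) ∈ 𝒢.secDom γ₂ :=
    hr.eventually (show 𝒢.secDom γ₂ ∈ 𝓝 (𝒢.r (𝒢.sec γ₁ (𝒢.s γ₁))) by
      rw [hr0]; exact 𝒢.secDom_mem_nhds γ₂)
  have hD' := 𝒢.secDom_mem_nhds γ₁
  have hc : ContinuousAt (fun x => 𝒢.mul (𝒢.sec γ₂ (𝒢.r (𝒢.sec γ₁ x))) (𝒢.sec γ₁ x)) (𝒢.s γ₁) := by
    have hsub : 𝒢.secDom γ₁ ∩ {x | 𝒢.r (𝒢.sec γ₁ x) ∈ 𝒢.secDom γ₂} ∈ 𝓝 (𝒢.s γ₁) :=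
      inter_mem hD' hD
    refine ContinuousOn.continuousAt ?_ hsub
    have h1 : ContinuousOn (𝒢.sec γ₁) (𝒢.secDom γ₁ ∩ {x | 𝒢.r (𝒢.sec γ₁ x) ∈ 𝒢.secDom γ₂}) :=
      (𝒢.continuousOn_sec γ₁).mono inter_subset_left
    have h2 : ContinuousOn (fun x => 𝒢.sec γ₂ (𝒢.r (𝒢.sec γ₁ x)))
        (𝒢.secDom γ₁ ∩ {x | 𝒢.r (𝒢.sec γ₁ x) ∈ 𝒢.secDom γ₂}) :=
      (𝒢.continuousOn_sec γ₂).comp (𝒢.continuous_r.comp_continuousOn h1) fun x hx => hx.2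
    exact 𝒢.continuousOn_mul.comp (h2.prodMk h1) fun x hx => 𝒢.s_sec _ hx.2
  refine 𝒢.betaAct_apply_of_eventually (hz.symm.trans hs.symm)
    (τ := fun x => 𝒢.mul (𝒢.sec γ₂ (𝒢.r (𝒢.sec γ₁ x))) (𝒢.sec γ₁ x)) ?_ ?_ ?_ f _ ?_
  · rw [hs]
    filter_upwards [hD, hD'] with x hx hx'
    rw [𝒢.s_mul _ _ (𝒢.s_sec _ hx), 𝒢.s_sec _ hx']
  · rwa [hs]
  · rw [hs, hr0, 𝒢.sec_self, 𝒢.sec_self]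
  · rw [hs]
    have h1 : ∀ᶠ y in 𝓝 (𝒢.r (𝒢.sec γ₁ (𝒢.s γ₁))), ∀ η, 𝒢.r η = y →
        (𝒢.transl γ₂ f).1 η = f.1 (𝒢.mul (𝒢.sec γ₂ y) η) := by
      rw [hr0]
      exact 𝒢.eventually_transl γ₂ f
    filter_upwards [hD, hD', hr.eventually h1, 𝒢.eventually_transl γ₁ (𝒢.transl γ₂ f)]
      with x hx hx' h2 h3 η hη
    have h4 : 𝒢.s (𝒢.sec γ₁ x) = 𝒢.r η := (𝒢.s_sec _ hx').trans hη.symm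
    rw [h3 η hη, h2 _ (𝒢.r_mul _ _ h4), 𝒢.mul_assoc _ _ _ (𝒢.s_sec _ hx) h4]

theorem continuousOn_betaAct :
    ContinuousOn (fun w : G × 𝒢.BetaR => 𝒢.betaAct w.1 w.2) {w | 𝒢.s w.1 = w.2.q} := by
  rw [continuousOn_iff_continuous_domRestrict]
  refine BetaR.continuous_of_eval fun f => ?_
  rw [continuous_iff_continuousAt]
  rintro ⟨⟨γ₀, z₀⟩, h₀⟩
  have h1 : Continuous fun w : {w : G × 𝒢.BetaR | 𝒢.s w.1 = w.2.q} => w.1.1 := by fun_prop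
  have h2 : Continuous fun w : {w : G × 𝒢.BetaR | 𝒢.s w.1 = w.2.q} => w.1.2 := by fun_prop
  have h3 := (BetaR.continuous_eval (𝒢.transl γ₀ f)).comp h2
  refine h3.continuousAt.congr ?_
  have e1 := (h1.tendsto ⟨(γ₀, z₀), h₀⟩).eventually (𝒢.eventually_sec_eq γ₀)
  have e2 := (((𝒢.continuous_s.comp h1)).tendsto ⟨(γ₀, z₀), h₀⟩).eventually
    (𝒢.eventually_transl γ₀ f).eventually_nhds
  have e3 := (((𝒢.continuous_s.comp h1)).tendsto ⟨(γ₀, z₀), h₀⟩).eventually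
    (𝒢.secDom_mem_nhds γ₀)
  filter_upwards [e1, e2, e3] with w hw1 hw2 hw3
  have hD : 𝒢.secDom γ₀ ∈ 𝓝 (𝒢.s w.1.1) := (𝒢.isOpen_secDom γ₀).mem_nhds hw3
  refine (𝒢.betaAct_apply_of_eventually (Eq.symm w.2) (τ := 𝒢.sec γ₀) ?_ ?_ hw1 f _ hw2).symm
  · filter_upwards [hD] with x hx
    exact 𝒢.s_sec γ₀ hx
  · exact (𝒢.continuousOn_sec γ₀).continuousAt hD

/-- `β_r𝒢` as a `𝒢`-space. -/
def betaGSpace : 𝒢.GSpace 𝒢.BetaR where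
  p := BetaR.q
  act := 𝒢.betaAct
  continuous_p := BetaR.continuous_q
  surjective_p := BetaR.surjective_q
  p_act := 𝒢.q_betaAct
  e_act := 𝒢.e_betaAct
  mul_act := 𝒢.mul_betaAct
  continuousOn_act := 𝒢.continuousOn_betaAct

end LocallyCompact

end EtaleGroupoid

/-! ## Semi-direct products, the map `Θ` -/

namespace EtaleGroupoid

variable {G X : Type*} [TopologicalSpace G] [TopologicalSpace X] (𝒢 : EtaleGroupoid G X)

theorem inv_mul_rev (a b : G) (h : 𝒢.s a = 𝒢.r b) :
    𝒢.inv (𝒢.mul a b) = 𝒢.mul (𝒢.inv b) (𝒢.inv a) := by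
  have h1 : 𝒢.s (𝒢.inv b) = 𝒢.r (𝒢.inv a) := by rw [𝒢.s_inv, 𝒢.r_inv, h]
  have h2 : 𝒢.r (𝒢.mul (𝒢.inv b) (𝒢.inv a)) = 𝒢.s b := by rw [𝒢.r_mul _ _ h1, 𝒢.r_inv]
  refine 𝒢.inv_eq_of_mul _ _ ((𝒢.s_mul _ _ h).trans h2.symm) ?_
  rw [𝒢.mul_assoc _ _ _ h h2.symm, 𝒢.inv_mul_cancel_left b (𝒢.inv a) (by rw [𝒢.r_inv, h]),
    𝒢.mul_inv, 𝒢.r_mul _ _ h]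

namespace GSpace

variable {𝒢} {Y : Type*} [TopologicalSpace Y] (𝒴 : 𝒢.GSpace Y)

/-- The space of arrows of the semi-direct product `Y ⋊ 𝒢`: pairs `(y, γ)` with `p(y) = r(γ)`. -/
abbrev Arrows : Type _ := {w : Y × G // 𝒴.p w.1 = 𝒢.r w.2}

theorem act_inv_act (γ : G) (y : Y) (h : 𝒴.p y = 𝒢.r γ) :
    𝒴.act γ (𝒴.act (𝒢.inv γ) y) = y := by
  rw [← 𝒴.mul_act _ _ _ (𝒢.r_inv γ).symm ((𝒢.s_inv γ).trans h.symm), 𝒢.mul_inv, ← h, 𝒴.e_act]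

theorem p_act_inv (γ : G) (y : Y) (h : 𝒴.p y = 𝒢.r γ) : 𝒴.p (𝒴.act (𝒢.inv γ) y) = 𝒢.s γ :=
  (𝒴.p_act _ _ ((𝒢.s_inv γ).trans h.symm)).trans (𝒢.r_inv γ)

theorem s_eq_r_of_comp {w w' : 𝒴.Arrows} (h : 𝒴.act (𝒢.inv w.1.2) w.1.1 = w'.1.1) :
    𝒢.s w.1.2 = 𝒢.r w'.1.2 := by
  rw [← w'.2, ← h, 𝒴.p_act_inv _ _ w.2]

open Classical in
/-- The product `(y, γ) (γ⁻¹ y, γ₁) = (y, γ γ₁)`. -/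
def arrowMul (w w' : 𝒴.Arrows) : 𝒴.Arrows :=
  if h : 𝒢.s w.1.2 = 𝒢.r w'.1.2 then
    ⟨(w.1.1, 𝒢.mul w.1.2 w'.1.2), w.2.trans (𝒢.r_mul _ _ h).symm⟩
  else w

theorem arrowMul_val {w w' : 𝒴.Arrows} (h : 𝒢.s w.1.2 = 𝒢.r w'.1.2) :
    (𝒴.arrowMul w w').1 = (w.1.1, 𝒢.mul w.1.2 w'.1.2) := by
  rw [arrowMul, dif_pos h]

theorem continuous_act_inv : Continuous fun w : 𝒴.Arrows => 𝒴.act (𝒢.inv w.1.2) w.1.1 := by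
  have h : Continuous fun w : 𝒴.Arrows => (𝒢.inv w.1.2, w.1.1) := by
    have := 𝒢.continuous_inv
    fun_prop
  exact 𝒴.continuousOn_act.comp_continuous h fun w => (𝒢.s_inv _).trans w.2.symm

theorem isLocalHomeomorph_fst : IsLocalHomeomorph fun w : 𝒴.Arrows => w.1.1 := by
  classical
  refine IsLocalHomeomorph.mk _ fun w₀ => ?_
  set E := 𝒢.isLocalHomeomorph_r.localInverseAt w₀.1.2 with hE
  have hrE : ∀ x ∈ E.source, 𝒢.r (E x) = x := fun x hx =>
    𝒢.isLocalHomeomorph_r.apply_localInverseAt_of_mem hx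
  have hEr : ∀ γ ∈ E.target, 𝒢.r γ ∈ E.source ∧ E (𝒢.r γ) = γ := fun γ hγ => by
    have h1 := E.map_target hγ
    have h2 := E.right_inv hγ
    rw [hE, IsLocalHomeomorph.localInverseAt_symm] at h1 h2
    exact ⟨h1, h2⟩
  let g : Y → 𝒴.Arrows := fun y =>
    if h : 𝒴.p y ∈ E.source then ⟨(y, E (𝒴.p y)), (hrE _ h).symm⟩ else w₀
  have hg : ∀ y, 𝒴.p y ∈ E.source → (g y).1 = (y, E (𝒴.p y)) := fun y h => by
    simp only [g, dif_pos h]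
  refine ⟨{ toFun := fun w => w.1.1
            invFun := g
            source := {w | w.1.2 ∈ E.target}
            target := {y | 𝒴.p y ∈ E.source}
            map_source' := fun w hw => ?_
            map_target' := fun y hy => ?_
            left_inv' := fun w hw => ?_
            right_inv' := fun y hy => ?_
            open_source := E.open_target.preimage (by fun_prop)
            open_target := E.open_source.preimage 𝒴.continuous_p
            continuousOn_toFun := by fun_prop
            continuousOn_invFun := ?_ }, ?_, ?_⟩
  · change 𝒴.p w.1.1 ∈ E.source
    rw [w.2]
    exact (hEr _ hw).1
  · change (g y).1.2 ∈ E.target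
    rw [hg y hy]
    exact E.map_source hy
  · have h1 := hEr _ hw
    rw [← w.2] at h1
    apply Subtype.ext
    rw [hg _ h1.1, h1.2]
  · rw [hg y hy]
  · rw [IsEmbedding.subtypeVal.isInducing.continuousOn_iff]
    refine ContinuousOn.congr (f := fun y => (y, E (𝒴.p y))) ?_ fun y hy => hg y hy
    exact continuousOn_id.prodMk (E.continuousOn.comp 𝒴.continuous_p.continuousOn fun y hy => hy)
  · exact 𝒢.isLocalHomeomorph_r.self_mem_localInverseAt_target
  · exact fun w _ => rfl

/-- The semi-direct product `Y ⋊ 𝒢` of a `𝒢`-space `Y` and `𝒢`: the étale groupoid with units `Y`,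
arrows `(y, γ)` such that `p(y) = r(γ)`, `r(y, γ) = y`, `s(y, γ) = γ⁻¹ y`, product
`(y, γ) (γ⁻¹ y, γ₁) = (y, γ γ₁)` and inverse `(y, γ)⁻¹ = (γ⁻¹ y, γ⁻¹)`. -/
def semidirect : EtaleGroupoid 𝒴.Arrows Y where
  r w := w.1.1
  s w := 𝒴.act (𝒢.inv w.1.2) w.1.1
  e y := ⟨(y, 𝒢.e (𝒴.p y)), (𝒢.r_e _).symm⟩
  inv w := ⟨(𝒴.act (𝒢.inv w.1.2) w.1.1, 𝒢.inv w.1.2),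
    (𝒴.p_act_inv _ _ w.2).trans (𝒢.r_inv _).symm⟩
  mul := 𝒴.arrowMul
  r_e _ := rfl
  s_e y := by
    have h : 𝒢.inv (𝒢.e (𝒴.p y)) = 𝒢.e (𝒴.p y) := by
      refine 𝒢.inv_eq_of_mul _ _ (by rw [𝒢.s_e, 𝒢.r_e]) ?_
      have := 𝒢.e_mul (𝒢.e (𝒴.p y))
      rw [𝒢.r_e] at this ⊢
      exact this
    rw [h, 𝒴.e_act]
  r_inv _ := rfl
  s_inv w := by
    change 𝒴.act (𝒢.inv (𝒢.inv w.1.2)) _ = _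
    rw [𝒢.inv_inv, 𝒴.act_inv_act _ _ w.2]
  r_mul w w' h := by
    rw [𝒴.arrowMul_val (𝒴.s_eq_r_of_comp h)]
  s_mul w w' h := by
    have h1 := 𝒴.s_eq_r_of_comp h
    rw [𝒴.arrowMul_val h1, 𝒢.inv_mul_rev _ _ h1, 𝒴.mul_act, h]
    · rw [𝒢.s_inv, 𝒢.r_inv, h1]
    · rw [𝒢.s_inv, w.2]
  mul_assoc w w' w'' h h' := by
    have h1 := 𝒴.s_eq_r_of_comp h
    have h2 := 𝒴.s_eq_r_of_comp h'
    apply Subtype.ext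
    have h3 : 𝒢.s (𝒴.arrowMul w w').1.2 = 𝒢.r w''.1.2 := by
      rw [𝒴.arrowMul_val h1, 𝒢.s_mul _ _ h1, h2]
    have h4 : 𝒢.s w.1.2 = 𝒢.r (𝒴.arrowMul w' w'').1.2 := by
      rw [𝒴.arrowMul_val h2, 𝒢.r_mul _ _ h2, h1]
    rw [𝒴.arrowMul_val h3, 𝒴.arrowMul_val h4, 𝒴.arrowMul_val h1, 𝒴.arrowMul_val h2,
      𝒢.mul_assoc _ _ _ h1 h2]
  e_mul w := by
    apply Subtype.ext
    rw [𝒴.arrowMul_val (by rw [𝒢.s_e, w.2])]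
    change (w.1.1, 𝒢.mul (𝒢.e (𝒴.p w.1.1)) w.1.2) = w.1
    rw [w.2, 𝒢.e_mul]
  mul_e w := by
    apply Subtype.ext
    have h := 𝒴.p_act_inv _ _ w.2
    rw [𝒴.arrowMul_val (by rw [𝒢.r_e, h])]
    change (w.1.1, 𝒢.mul w.1.2 (𝒢.e (𝒴.p (𝒴.act (𝒢.inv w.1.2) w.1.1)))) = w.1
    rw [h, 𝒢.mul_e]
  mul_inv w := by
    apply Subtype.ext
    rw [𝒴.arrowMul_val (by rw [𝒢.r_inv])]
    change (w.1.1, 𝒢.mul w.1.2 (𝒢.inv w.1.2)) = (w.1.1, 𝒢.e (𝒴.p w.1.1))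
    rw [𝒢.mul_inv, w.2]
  inv_mul w := by
    apply Subtype.ext
    rw [𝒴.arrowMul_val (by rw [𝒢.s_inv])]
    change (𝒴.act (𝒢.inv w.1.2) w.1.1, 𝒢.mul (𝒢.inv w.1.2) w.1.2) =
      (𝒴.act (𝒢.inv w.1.2) w.1.1, 𝒢.e (𝒴.p (𝒴.act (𝒢.inv w.1.2) w.1.1)))
    rw [𝒢.inv_mul, 𝒴.p_act_inv _ _ w.2]
  continuous_e := by
    have h1 := 𝒢.continuous_e
    have h2 := 𝒴.continuous_p
    fun_prop
  continuous_inv := by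
    have h1 := 𝒢.continuous_inv
    have h2 := 𝒴.continuous_act_inv
    fun_prop
  continuousOn_mul := by
    rw [IsEmbedding.subtypeVal.isInducing.continuousOn_iff]
    refine ContinuousOn.congr (f := fun u : 𝒴.Arrows × 𝒴.Arrows =>
      (u.1.1.1, 𝒢.mul u.1.1.2 u.2.1.2)) ?_ fun u hu => 𝒴.arrowMul_val (𝒴.s_eq_r_of_comp hu)
    refine ContinuousOn.prodMk (by fun_prop) ?_
    exact 𝒢.continuousOn_mul.comp (f := fun u : 𝒴.Arrows × 𝒴.Arrows => (u.1.1.2, u.2.1.2))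
      (by fun_prop) fun u hu => 𝒴.s_eq_r_of_comp hu
  isLocalHomeomorph_r := 𝒴.isLocalHomeomorph_fst

end GSpace

variable [T2Space X] [LocallyCompactSpace X]

/-- The semi-direct product `β_r𝒢 ⋊ 𝒢`. -/
abbrev betaSemidirect : EtaleGroupoid 𝒢.betaGSpace.Arrows 𝒢.BetaR := 𝒢.betaGSpace.semidirect

/-- The function `f ∘ π` in `C_c(β_r𝒢 ⋊ 𝒢)`, for `f ∈ C_c(𝒢)`, where `π` is the second
projection. -/
def pullCc (f : C_c(G, ℂ)) : C_c(𝒢.betaGSpace.Arrows, ℂ) where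
  toFun w := f w.1.2
  continuous_toFun := f.continuous.comp (by fun_prop)
  hasCompactSupport' := by
    have h1 : IsCompact (tsupport f) := f.hasCompactSupport
    have h2 := (BetaR.isCompact_preimage_q (𝒢 := 𝒢) (h1.image 𝒢.continuous_r)).prod h1
    have h3 : IsClosed {w : 𝒢.BetaR × G | w.1.q = 𝒢.r w.2} :=
      isClosed_eq (BetaR.continuous_q.comp continuous_fst) (𝒢.continuous_r.comp continuous_snd)
    have h4 : IsCompact (Subtype.val ⁻¹' ((BetaR.q (𝒢 := 𝒢) ⁻¹' (𝒢.r '' tsupport f)) ×ˢ tsupport f)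
        : Set 𝒢.betaGSpace.Arrows) := (IsClosedEmbedding.subtypeVal h3).isCompact_preimage h2
    refine h4.of_isClosed_subset (isClosed_tsupport _) (closure_minimal ?_ ?_)
    · intro w hw
      have h5 : w.1.2 ∈ tsupport f := subset_tsupport _ hw
      refine ⟨?_, h5⟩
      change w.1.1.q ∈ 𝒢.r '' tsupport f
      rw [show w.1.1.q = 𝒢.r w.1.2 from w.2]
      exact mem_image_of_mem _ h5
    · refine IsClosed.preimage continuous_subtype_val (IsClosed.prod ?_ (isClosed_tsupport f))
      exact (h1.image 𝒢.continuous_r).isClosed.preimage BetaR.continuous_q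

theorem pullCc_apply (f : C_c(G, ℂ)) (w : 𝒢.betaGSpace.Arrows) : 𝒢.pullCc f w = f w.1.2 := rfl

/-- The arrow `(i(γ⁻¹), γ⁻¹ γ₁)` of `β_r𝒢 ⋊ 𝒢`, for `(γ, γ₁) ∈ 𝒢 *_r 𝒢`. -/
def thetaArrow (p : 𝒢.RangePairs) : 𝒢.betaGSpace.Arrows :=
  ⟨(toBeta (𝒢.inv p.1.1), 𝒢.leftDiv p), (q_toBeta _).trans
    (𝒢.r_mul _ _ ((𝒢.s_inv p.1.1).trans p.2)).symm⟩

theorem continuous_thetaArrow : Continuous 𝒢.thetaArrow := by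
  have h1 := continuous_toBeta (𝒢 := 𝒢)
  have h2 := 𝒢.continuous_inv
  have h3 := 𝒢.continuous_leftDiv
  unfold thetaArrow
  fun_prop

/-- The kernel `Θ(f) ∈ 𝒞_t(𝒢 *_r 𝒢)` for `f ∈ C_c(β_r𝒢 ⋊ 𝒢)`:
`Θ(f)(γ, γ₁) = f(i(γ⁻¹), γ⁻¹ γ₁)`. -/
def Theta [T2Space G] (f : C_c(𝒢.betaGSpace.Arrows, ℂ)) : 𝒢.TubeKernel :=
  ⟨(f : 𝒢.betaGSpace.Arrows →ᵇ ℂ).compContinuous ⟨𝒢.thetaArrow, 𝒢.continuous_thetaArrow⟩,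
    TubeKernel.mem_of_isCompact
      (K := (fun w : 𝒢.betaGSpace.Arrows => w.1.2) '' tsupport f)
      (IsCompact.image f.hasCompactSupport (by fun_prop))
      fun p hp => ⟨𝒢.thetaArrow p, subset_tsupport _ hp, rfl⟩⟩

theorem Theta_app [T2Space G] (f : C_c(𝒢.betaGSpace.Arrows, ℂ)) (γ γ₁ : G) (h : 𝒢.r γ = 𝒢.r γ₁) :
    (𝒢.Theta f).app γ γ₁ h = f (𝒢.thetaArrow ⟨(γ, γ₁), h⟩) := rfl

/-- `Θ` maps `f ∘ π` to the kernel `(γ, γ₁) ↦ f(γ⁻¹ γ₁)`. -/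
theorem Theta_pullCc [T2Space G] (f : C_c(G, ℂ)) : 𝒢.Theta (𝒢.pullCc f) = 𝒢.ccKernel f := rfl

end EtaleGroupoid

end

/-!
The proof compares operators fibre by fibre. Every adjointable operator `T` on `ℰ = ℓ²_{C₀(X)}(𝒢)`
is `C₀(X)`-linear, hence has fibres `Tₓ` on the Hilbert spaces `ℓ²(𝒢ˣ)`, and `T ↦ Tₓ` is a
`⋆`-homomorphism (`fibreRep`). The norms `x ↦ ‖ξₓ‖` being continuous for `ξ ∈ ℰ`, the norm of `T`
is the supremum of `‖Tₓ‖` over any dense set of points `x` (`norm_le_of_fibreRep`).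

For `η ∈ 𝒢` the bijection `(i(η), g) ↦ η⁻¹ g` from the fibre of `β_r𝒢 ⋊ 𝒢` over `i(η)` to the
fibre of `𝒢` over `s(η)` carries the matrix of `Λ'(f)` to the matrix of `T(Θ(f))`
(`matrix_ccKernel_toBeta`). The points `i(η)` are dense in `β_r𝒢` (`denseRange_toBeta`), and every
point of `X` is of the form `s(η)`. So the pairs `(T, S)` of operators whose fibres over `i(η)`
and `s(η)` correspond for every `η` form a closed `⋆`-subalgebra on which both coordinates are
isometric, and it contains all pairs `(Λ'(f), T(Θ(f)))`. The closed `⋆`-algebra generated by these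
pairs is therefore the graph of an isometric isomorphism between the algebras generated by the
operators `Λ'(f)` and by the operators `T(Θ(f))`
(`exists_isometry_starAlgEquiv_of_representations`); no formula for the convolution product is
needed.

Finally `Θ` is onto (`surjective_Theta`): by a partition of unity, a kernel with support in a tube
is a sum of kernels supported in sets `{(γ, γ₁) : γ⁻¹ γ₁ ∈ U}` with `r` injective on `U`, and such
a kernel amounts to a bounded continuous function of `γ⁻¹`, which extends to `β_r𝒢`. Hence the
operators `T(Θ(f))` generate the uniform algebra. It contains the reduced algebra of `𝒢`, and `ι`
is the restriction of `Φ⁻¹` to the latter.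
-/

noncomputable section

/-! ### Star subalgebras along isometric homomorphisms -/

/-- An isometric `⋆`-homomorphism from a complete `⋆`-algebra identifies the closed `⋆`-subalgebra
generated by a family with the one generated by the image of the family. -/
theorem exists_starAlgEquiv_of_isometry {D A S : Type*} [NonUnitalNormedRing D] [StarRing D]
    [NormedStarGroup D] [NormedSpace ℂ D] [IsScalarTower ℂ D D] [SMulCommClass ℂ D D]
    [StarModule ℂ D] [CompleteSpace D] [NonUnitalNormedRing A] [StarRing A] [NormedStarGroup A]
    [NormedSpace ℂ A] [IsScalarTower ℂ A A] [SMulCommClass ℂ A A] [StarModule ℂ A]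
    (p : D →⋆ₙₐ[ℂ] A) (hp : Isometry p) (d : S → D) (a : S → A) (h : ∀ s, p (d s) = a s) :
    ∃ e : (NonUnitalStarAlgebra.adjoin ℂ (range d)).topologicalClosure ≃⋆ₐ[ℂ]
      (NonUnitalStarAlgebra.adjoin ℂ (range a)).topologicalClosure, ∀ w, (e w : A) = p w := by
  have h1 : (NonUnitalStarAlgebra.adjoin ℂ (range a)).topologicalClosure =
      NonUnitalStarSubalgebra.map p
        (NonUnitalStarAlgebra.adjoin ℂ (range d)).topologicalClosure := by
    rw [← NonUnitalStarSubalgebra.topologicalClosure_map _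
      hp.isClosedEmbedding.isClosedMap hp.continuous, NonUnitalStarAlgHom.map_adjoin, ← range_comp]
    congr 3
    exact funext fun s => (h s).symm
  have hm : ∀ w : (NonUnitalStarAlgebra.adjoin ℂ (range d)).topologicalClosure,
      p w ∈ (NonUnitalStarAlgebra.adjoin ℂ (range a)).topologicalClosure := fun w => by
    rw [h1]
    exact ⟨w, w.2, rfl⟩
  refine ⟨StarAlgEquiv.ofBijective (NonUnitalStarAlgHom.codRestrict
    (p.comp (NonUnitalStarSubalgebraClass.subtype _)) _ hm) ⟨fun v w hvw => ?_, fun x => ?_⟩,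
    fun w => rfl⟩
  · exact Subtype.ext (hp.injective (congrArg Subtype.val hvw))
  · obtain ⟨w, hw, hwx⟩ := h1.le x.2
    exact ⟨⟨w, hw⟩, Subtype.ext hwx⟩

/-- Let `ρᵢ` and `σᵢ` be representations of `A` and `B` in the same algebras `Cᵢ`, such that the
norms of `A` and `B` are the suprema of the norms in these representations. If the families `a` and
`b` have the same images in all `Cᵢ`, then the closed `⋆`-subalgebras that they generate are
isomorphic, by an isometry mapping `a s` to `b s`. Indeed both coordinates are isometric on the
closed `⋆`-subalgebra of those `(x, y) ∈ A × B` such that `ρᵢ x = σᵢ y` for all `i`. -/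
theorem exists_isometry_starAlgEquiv_of_representations {A B I S : Type*} {C : I → Type*}
    [NonUnitalCStarAlgebra A] [NonUnitalCStarAlgebra B] [∀ i, NonUnitalCStarAlgebra (C i)]
    (ρ : ∀ i, A →⋆ₙₐ[ℂ] C i) (σ : ∀ i, B →⋆ₙₐ[ℂ] C i)
    (hρ : ∀ x r, 0 ≤ r → (∀ i, ‖ρ i x‖ ≤ r) → ‖x‖ ≤ r)
    (hσ : ∀ y r, 0 ≤ r → (∀ i, ‖σ i y‖ ≤ r) → ‖y‖ ≤ r)
    (a : S → A) (b : S → B) (hab : ∀ i s, ρ i (a s) = σ i (b s)) :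
    ∃ Φ : (NonUnitalStarAlgebra.adjoin ℂ (range a)).topologicalClosure ≃⋆ₐ[ℂ]
      (NonUnitalStarAlgebra.adjoin ℂ (range b)).topologicalClosure,
      Isometry Φ ∧ ∀ s (v : (NonUnitalStarAlgebra.adjoin ℂ (range a)).topologicalClosure),
        (v : A) = a s → (Φ v : B) = b s := by
  let P : NonUnitalStarSubalgebra ℂ (A × B) := ⨅ i, NonUnitalStarAlgHom.equalizer
    ((ρ i).comp (NonUnitalStarAlgHom.fst ℂ A B)) ((σ i).comp (NonUnitalStarAlgHom.snd ℂ A B))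
  have hmem : ∀ w : A × B, w ∈ P ↔ ∀ i, ρ i w.1 = σ i w.2 := fun w =>
    NonUnitalStarAlgebra.mem_iInf
  have hclosed : IsClosed (P : Set (A × B)) := by
    have h : (P : Set (A × B)) = ⋂ i, {w | ρ i w.1 = σ i w.2} := by
      ext w
      rw [mem_iInter]
      exact hmem w
    rw [h]
    have hρc : ∀ i, Continuous (ρ i) := fun i =>
      AddMonoidHomClass.continuous_of_bound (ρ i) 1 fun x => by
        simpa using NonUnitalStarAlgHom.norm_apply_le (ρ i) x
    have hσc : ∀ i, Continuous (σ i) := fun i =>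
      AddMonoidHomClass.continuous_of_bound (σ i) 1 fun y => by
        simpa using NonUnitalStarAlgHom.norm_apply_le (σ i) y
    exact isClosed_iInter fun i => isClosed_eq ((hρc i).comp continuous_fst)
      ((hσc i).comp continuous_snd)
  have : CompleteSpace P := hclosed.completeSpace_coe
  have hnorm : ∀ w : P, ‖w.1.1‖ = ‖w.1.2‖ := fun w => by
    have h := (hmem w.1).1 w.2
    refine le_antisymm (hρ _ _ (norm_nonneg _) fun i => ?_) (hσ _ _ (norm_nonneg _) fun i => ?_)
    · rw [h]
      exact NonUnitalStarAlgHom.norm_apply_le _ _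
    · rw [← h]
      exact NonUnitalStarAlgHom.norm_apply_le _ _
  let d : S → P := fun s => ⟨(a s, b s), (hmem _).2 fun i => hab i s⟩
  let p : P →⋆ₙₐ[ℂ] A :=
    (NonUnitalStarAlgHom.fst ℂ A B).comp (NonUnitalStarSubalgebraClass.subtype P)
  let q : P →⋆ₙₐ[ℂ] B :=
    (NonUnitalStarAlgHom.snd ℂ A B).comp (NonUnitalStarSubalgebraClass.subtype P)
  have hp : ∀ w, ‖p w‖ = ‖w‖ := fun w => (max_eq_left (hnorm w).ge).symm
  have hq : ∀ w, ‖q w‖ = ‖w‖ := fun w => (max_eq_right (hnorm w).le).symm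
  obtain ⟨e₁, h₁⟩ := exists_starAlgEquiv_of_isometry p
    (AddMonoidHomClass.isometry_of_norm p hp) d a fun s => rfl
  obtain ⟨e₂, h₂⟩ := exists_starAlgEquiv_of_isometry q
    (AddMonoidHomClass.isometry_of_norm q hq) d b fun s => rfl
  have hn₁ : ∀ w, ‖e₁ w‖ = ‖w‖ := fun w => (congrArg norm (h₁ w)).trans (hp w)
  have hn₂ : ∀ w, ‖e₂ w‖ = ‖w‖ := fun w => (congrArg norm (h₂ w)).trans (hq w)
  refine ⟨e₁.symm.trans e₂, AddMonoidHomClass.isometry_of_norm _ fun v => ?_, fun s v hv => ?_⟩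
  · change ‖e₂ (e₁.symm v)‖ = ‖v‖
    rw [hn₂, ← hn₁, e₁.apply_symm_apply]
  · let w : (NonUnitalStarAlgebra.adjoin ℂ (range d)).topologicalClosure :=
      ⟨d s, NonUnitalStarSubalgebra.le_topologicalClosure _
        (NonUnitalStarAlgebra.subset_adjoin ℂ _ (mem_range_self s))⟩
    have hw : v = e₁ w := Subtype.ext (hv.trans (h₁ w).symm)
    rw [hw]
    change (e₂ (e₁.symm (e₁ w)) : B) = _
    rw [e₁.symm_apply_apply]
    exact h₂ w

/-- An isometric isomorphism `R' ≃ U` has an isometric inverse on every `⋆`-subalgebra `R ≤ U`. -/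
theorem exists_isometry_section {A A' : Type*} [NonUnitalNormedRing A] [StarRing A] [Module ℂ A]
    [NonUnitalNormedRing A'] [StarRing A'] [Module ℂ A'] {R' : NonUnitalStarSubalgebra ℂ A'}
    {R U : NonUnitalStarSubalgebra ℂ A} (h : R ≤ U) (Φ : R' ≃⋆ₐ[ℂ] U) (hΦ : Isometry Φ) :
    ∃ ι : R →⋆ₙₐ[ℂ] R', Isometry ι ∧ (∀ (a : R) (b : R'), (Φ b : A) = a → ι a = b) ∧
      ∀ a, (Φ (ι a) : A) = a := by
  let ι : R →⋆ₙₐ[ℂ] R' :=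
    (Φ.symm : U →⋆ₙₐ[ℂ] R').comp (NonUnitalStarSubalgebra.inclusion h)
  have hι : ∀ a : R, (Φ (ι a) : A) = a := fun a =>
    congrArg Subtype.val (Φ.apply_symm_apply (NonUnitalStarSubalgebra.inclusion h a))
  refine ⟨ι, Isometry.of_dist_eq fun a b => ?_, fun a b hb => ?_, hι⟩
  · rw [← hΦ.dist_eq, Subtype.dist_eq, hι, hι, Subtype.dist_eq]
  · exact Φ.injective (Subtype.ext ((hι a).trans hb.symm))

/-! ### Reindexing `ℓ²` -/

/-- The unitary operator `ℓ²(ι) → ℓ²(κ)` given by a bijection `ι ≃ κ`. -/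
def l2Reindex {ι κ : Type*} (e : ι ≃ κ) :
    lp (fun _ : ι => ℂ) 2 ≃ₗᵢ[ℂ] lp (fun _ : κ => ℂ) 2 where
  toFun f := ⟨fun j => f (e.symm j), (memℓp_gen_iff (by simp)).2
    ((e.symm.summable_iff (f := fun i => ‖f i‖ ^ (2 : ℝ≥0∞).toReal)).2
      ((memℓp_gen_iff (by simp)).1 (lp.memℓp f)))⟩
  invFun f := ⟨fun i => f (e i), (memℓp_gen_iff (by simp)).2
    ((e.summable_iff (f := fun i => ‖f i‖ ^ (2 : ℝ≥0∞).toReal)).2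
      ((memℓp_gen_iff (by simp)).1 (lp.memℓp f)))⟩
  map_add' f g := rfl
  map_smul' c f := rfl
  left_inv f := by
    ext i
    exact congrArg f (e.symm_apply_apply i)
  right_inv f := by
    ext j
    exact congrArg f (e.apply_symm_apply j)
  norm_map' f := by
    rw [lp.norm_eq_tsum_rpow (by simp), lp.norm_eq_tsum_rpow (by simp)]
    congr 1
    exact e.symm.tsum_eq fun i => ‖f i‖ ^ (2 : ℝ≥0∞).toReal

theorem l2Reindex_apply {ι κ : Type*} (e : ι ≃ κ) (f : lp (fun _ : ι => ℂ) 2) (j : κ) :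
    l2Reindex e f j = f (e.symm j) := rfl

/-- Matrix operators are intertwined by a bijection of the index sets that matches the entries. -/
theorem IsBandMatrix.l2Reindex_toCLM {ι κ : Type*} (e : ι ≃ κ) {k : ι → ι → ℂ} {l : κ → κ → ℂ}
    {C C' : ℝ} {N N' : ℕ} (hk : IsBandMatrix k C N) (hl : IsBandMatrix l C' N')
    (h : ∀ i j, k i j = l (e i) (e j)) (f : lp (fun _ : ι => ℂ) 2) :
    l2Reindex e (hk.toCLM f) = hl.toCLM (l2Reindex e f) := by
  ext j
  rw [l2Reindex_apply, IsBandMatrix.toCLM_apply, IsBandMatrix.toCLM_apply, ← e.tsum_eq]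
  refine tsum_congr fun i => ?_
  rw [h, l2Reindex_apply, e.apply_symm_apply, e.symm_apply_apply]

/-! ### The fibres of an adjointable operator -/

namespace EtaleGroupoid

section Fibres

variable {G X : Type*} [TopologicalSpace G] [TopologicalSpace X] {𝒢 : EtaleGroupoid G X}
  [T2Space G] [T2Space X]

namespace L2

variable (𝒢) in
/-- The evaluation `ξ ↦ ξₓ` of elements of `ℰ` at a point of `X`. -/
def ev (x : X) : 𝒢.L2 →ₗ[ℂ] 𝒢.FiberL2 x where
  toFun ξ := val ξ x
  map_add' _ _ := rfl
  map_smul' _ _ := rfl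

theorem ev_incl (x : X) (ξ : C_c(G, ℂ)) (γ : 𝒢.Fiber x) : ev 𝒢 x (incl 𝒢 ξ) γ = ξ γ := rfl

theorem ev_smul (x : X) (f : C₀(X, ℂ)) (ξ : 𝒢.L2) : ev 𝒢 x (f • ξ) = f x • ev 𝒢 x ξ := rfl

theorem inner_ev (x : X) (ξ η : 𝒢.L2) :
    inner ℂ (ev 𝒢 x ξ) (ev 𝒢 x η) = inner C₀(X, ℂ) ξ η x := rfl

theorem norm_ev_le (x : X) (ξ : 𝒢.L2) : ‖ev 𝒢 x ξ‖ ≤ ‖ξ‖ :=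
  lp.norm_apply_le_norm (by simp) (val ξ) x

theorem norm_le_of_ev {ξ : 𝒢.L2} {C : ℝ} (hC : 0 ≤ C) (h : ∀ x, ‖ev 𝒢 x ξ‖ ≤ C) : ‖ξ‖ ≤ C :=
  lp.norm_le_of_forall_le (f := val ξ) hC h

theorem continuous_norm_ev (ξ : 𝒢.L2) : Continuous fun x => ‖ev 𝒢 x ξ‖ := by
  have h : ∀ x, ‖ev 𝒢 x ξ‖ = √‖inner C₀(X, ℂ) ξ ξ x‖ := fun x => by
    rw [← inner_ev, inner_self_eq_norm_sq_to_K]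
    simp
  simp_rw [h]
  have := (inner C₀(X, ℂ) ξ ξ).continuous
  fun_prop

end L2

/-- Adjointable operators are `C₀(X)`-linear. -/
theorem toCLM_smul (T : Adjointable C₀(X, ℂ) 𝒢.L2) (f : C₀(X, ℂ)) (ξ : 𝒢.L2) :
    T.toCLM (f • ξ) = f • T.toCLM ξ := by
  rw [← sub_eq_zero, ← CStarModule.inner_self (A := C₀(X, ℂ))]
  generalize hη : T.toCLM (f • ξ) - f • T.toCLM ξ = η
  nth_rewrite 2 [← hη]
  rw [CStarModule.inner_sub_right, ← Adjointable.inner_star', CStarModule.inner_op_smul_right,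
    CStarModule.inner_op_smul_right, Adjointable.inner_star', sub_self]

/-- The point masses on the fibre are restrictions of functions supported in open sets on which `r`
is injective. -/
theorem L2.denseRange_ev [LocallyCompactSpace G] (x : X) : DenseRange (L2.ev 𝒢 x) := by
  classical
  have hsingle : ∀ γ : 𝒢.Fiber x, lp.single 2 γ (1 : ℂ) ∈ LinearMap.range (L2.ev 𝒢 x) := by
    intro γ
    obtain ⟨U, hU, hγU, hinj⟩ := 𝒢.isLocalHomeomorph_r.isLocallyInjective (γ : G)
    obtain ⟨ψ, h1, h2, h3⟩ := exists_bump (γ : G) (hU.mem_nhds hγU)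
    refine ⟨L2.incl 𝒢 ⟨⟨ψ, ψ.continuous⟩, h2⟩, ?_⟩
    ext γ'
    rw [L2.ev_incl]
    change ψ γ' = _
    by_cases h : γ' = γ
    · subst h
      rw [h1.self_of_nhds, lp.single_apply_self]
    · rw [lp.single_apply_ne _ _ _ h]
      by_contra h0
      exact h (Subtype.ext (hinj (h3.1 (subset_tsupport _ h0)) hγU (γ'.2.trans γ.2.symm)))
  have htop : (LinearMap.range (L2.ev 𝒢 x)).topologicalClosure = ⊤ := by
    refine eq_top_iff.2 fun f _ => ?_
    refine mem_closure_of_tendsto (lp.hasSum_single (by simp) f) (Eventually.of_forall fun s => ?_)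
    refine Submodule.sum_mem _ fun γ _ => ?_
    have : lp.single (E := fun _ : 𝒢.Fiber x => ℂ) 2 γ (f γ) = f γ • lp.single 2 γ (1 : ℂ) := by
      rw [← lp.single_smul, smul_eq_mul, mul_one]
    rw [this]
    exact Submodule.smul_mem _ _ (hsingle γ)
  rw [DenseRange, ← LinearMap.coe_range, Submodule.dense_iff_topologicalClosure_eq_top, htop]

/-- Multiplying `ξ` by a cut-off function near `x` makes `‖ξ‖` as close to `‖ξₓ‖` as desired, and
`T` commutes with such multiplications. -/
theorem norm_ev_toCLM_le [LocallyCompactSpace X] (T : Adjointable C₀(X, ℂ) 𝒢.L2) (x : X)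
    (ξ : 𝒢.L2) :
    ‖L2.ev 𝒢 x (T.toCLM ξ)‖ ≤ ‖T‖ * ‖L2.ev 𝒢 x ξ‖ := by
  have key : ∀ ε > 0, ‖L2.ev 𝒢 x (T.toCLM ξ)‖ ≤ ‖T‖ * (‖L2.ev 𝒢 x ξ‖ + ε) := by
    intro ε hε
    obtain ⟨ψ, h1, h2, h3, h4⟩ := exists_bump x
      ((L2.continuous_norm_ev ξ).continuousAt.eventually (gt_mem_nhds (lt_add_of_pos_right _ hε)))
    have e : L2.ev 𝒢 x (T.toCLM ξ) = L2.ev 𝒢 x (T.toCLM (c0OfCompact ψ h2 • ξ)) := by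
      rw [toCLM_smul, L2.ev_smul]
      change _ = ψ x • _
      rw [h1.self_of_nhds, one_smul]
    rw [e]
    refine (L2.norm_ev_le _ _).trans ((T.toCLM.le_opNorm _).trans ?_)
    rw [Adjointable.norm_toCLM]
    refine mul_le_mul_of_nonneg_left (L2.norm_le_of_ev (by positivity) fun y => ?_) (norm_nonneg T)
    rw [L2.ev_smul, norm_smul]
    change ‖ψ y‖ * _ ≤ _
    by_cases hy : ψ y = 0
    · rw [hy, norm_zero, zero_mul]
      positivity
    · have h5 : ‖L2.ev 𝒢 y ξ‖ < ‖L2.ev 𝒢 x ξ‖ + ε := h3 (subset_tsupport _ hy)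
      exact (mul_le_of_le_one_left (norm_nonneg _) (h4 y)).trans h5.le
  have hlim : Tendsto (fun ε : ℝ => ‖T‖ * (‖L2.ev 𝒢 x ξ‖ + ε)) (𝓝[>] 0)
      (𝓝 (‖T‖ * (‖L2.ev 𝒢 x ξ‖ + 0))) :=
    ((by fun_prop : Continuous fun ε : ℝ => ‖T‖ * (‖L2.ev 𝒢 x ξ‖ + ε)).tendsto 0).mono_left
      nhdsWithin_le_nhds
  rw [add_zero] at hlim
  exact ge_of_tendsto hlim (eventually_mem_nhdsWithin.mono key)

theorem L2.clm_ext_ev [LocallyCompactSpace G] {x : X} {F : Type*} [NormedAddCommGroup F]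
    [NormedSpace ℂ F] {S S' : 𝒢.FiberL2 x →L[ℂ] F}
    (h : ∀ ξ : 𝒢.L2, S (L2.ev 𝒢 x ξ) = S' (L2.ev 𝒢 x ξ)) : S = S' :=
  ContinuousLinearMap.coeFn_injective
    ((L2.denseRange_ev x).equalizer S.continuous S'.continuous (funext h))

variable (𝒢) in
theorem reducedCStar_le_uniformCStar : 𝒢.reducedCStar ≤ 𝒢.uniformCStar := by
  refine NonUnitalStarSubalgebra.topologicalClosure_mono (NonUnitalStarAlgebra.adjoin_mono ?_)
  rintro _ ⟨f, rfl⟩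
  exact ⟨𝒢.ccKernel f, rfl⟩

variable [LocallyCompactSpace X] [LocallyCompactSpace G]

/-- The operator `Tₓ` on `ℓ²(𝒢ˣ)` with `Tₓ ξₓ = (T ξ)ₓ`. -/
def fibreOp (x : X) (T : Adjointable C₀(X, ℂ) 𝒢.L2) : 𝒢.FiberL2 x →L[ℂ] 𝒢.FiberL2 x :=
  ((L2.ev 𝒢 x).comp T.toCLM.toLinearMap).extendOfNorm (L2.ev 𝒢 x)

theorem fibreOp_ev (x : X) (T : Adjointable C₀(X, ℂ) 𝒢.L2) (ξ : 𝒢.L2) :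
    fibreOp x T (L2.ev 𝒢 x ξ) = L2.ev 𝒢 x (T.toCLM ξ) :=
  LinearMap.extendOfNorm_eq (L2.denseRange_ev x) ⟨‖T‖, norm_ev_toCLM_le T x⟩ ξ

variable (𝒢) in
/-- The representation `T ↦ Tₓ` of `𝓑(ℰ)` on the Hilbert space `ℓ²(𝒢ˣ)`. -/
def fibreRep (x : X) :
    Adjointable C₀(X, ℂ) 𝒢.L2 →⋆ₙₐ[ℂ] (𝒢.FiberL2 x →L[ℂ] 𝒢.FiberL2 x) where
  toFun := fibreOp x
  map_zero' := L2.clm_ext_ev fun ξ => by simp [fibreOp_ev]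
  map_add' T S := L2.clm_ext_ev fun ξ => by simp [fibreOp_ev]
  map_smul' c T := L2.clm_ext_ev fun ξ => by simp [fibreOp_ev]
  map_mul' T S := L2.clm_ext_ev fun ξ => by simp [fibreOp_ev]
  map_star' T := by
    refine (ContinuousLinearMap.eq_adjoint_iff _ _).2 ?_
    intro u v
    refine (L2.denseRange_ev x).induction_on₂ (p := fun u v =>
      inner ℂ (fibreOp x (star T) u) v = inner ℂ u (fibreOp x T v))
      (isClosed_eq (by fun_prop) (by fun_prop)) (fun ξ η => ?_) u v
    rw [fibreOp_ev, fibreOp_ev, L2.inner_ev, L2.inner_ev, Adjointable.inner_star']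

theorem fibreRep_ev (x : X) (T : Adjointable C₀(X, ℂ) 𝒢.L2) (ξ : 𝒢.L2) :
    𝒢.fibreRep x T (L2.ev 𝒢 x ξ) = L2.ev 𝒢 x (T.toCLM ξ) := fibreOp_ev x T ξ

/-- The norm of an adjointable operator is the supremum of the norms of its fibres over any dense
set of points, since `x ↦ ‖ξₓ‖` is continuous for `ξ ∈ ℰ`. -/
theorem norm_le_of_fibreRep {Y : Type*} {j : Y → X} (hj : DenseRange j)
    (T : Adjointable C₀(X, ℂ) 𝒢.L2) {C : ℝ} (hC : 0 ≤ C) (h : ∀ y, ‖𝒢.fibreRep (j y) T‖ ≤ C) :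
    ‖T‖ ≤ C := by
  refine T.toCLM.opNorm_le_bound hC fun ξ => L2.norm_le_of_ev (by positivity) fun x => ?_
  refine hj.induction_on (p := fun x => ‖L2.ev 𝒢 x (T.toCLM ξ)‖ ≤ C * ‖ξ‖) x
    (isClosed_le (L2.continuous_norm_ev _) continuous_const) fun y => ?_
  rw [← fibreRep_ev]
  refine (ContinuousLinearMap.le_opNorm _ _).trans ?_
  have := h y
  have := L2.norm_ev_le (j y) ξ
  gcongr

/-- The fibre over `x` of the operator `T(k)` is given by the matrix of `k` on `𝒢ˣ`. -/
theorem fibreRep_op (k : 𝒢.TubeKernel) (x : X) :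
    𝒢.fibreRep x k.op = (k.isBandMatrix x).toCLM :=
  L2.clm_ext_ev fun ξ => fibreRep_ev x k.op ξ

/-! ### Isomorphisms given by matching fibres -/

variable {H Y : Type*} [TopologicalSpace H] [TopologicalSpace Y] [T2Space H] [T2Space Y]
  [LocallyCompactSpace H] [LocallyCompactSpace Y] {ℋ : EtaleGroupoid H Y}

/-- Let `Uᵢ : ℓ²(ℋ^{y(i)}) → ℓ²(𝒢^{x(i)})` be unitary operators, where the points `y(i)` and the
points `x(i)` are dense. If the fibres of `a s` and `b s` correspond under all `Uᵢ`, then the closed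
`⋆`-subalgebras generated by the families `a` and `b` are isomorphic. The range of
`b` is passed as a set `t`. -/
theorem exists_isometry_of_fibreRep {I S : Type*} {y : I → Y} {x : I → X} (hy : DenseRange y)
    (hx : DenseRange x) (U : ∀ i, ℋ.FiberL2 (y i) ≃ₗᵢ[ℂ] 𝒢.FiberL2 (x i))
    (a : S → Adjointable C₀(Y, ℂ) ℋ.L2) (b : S → Adjointable C₀(X, ℂ) 𝒢.L2)
    {t : Set (Adjointable C₀(X, ℂ) 𝒢.L2)} (ht : range b = t)
    (hab : ∀ i s v, U i (ℋ.fibreRep (y i) (a s) v) = 𝒢.fibreRep (x i) (b s) (U i v)) :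
    ∃ Φ : (NonUnitalStarAlgebra.adjoin ℂ (range a)).topologicalClosure ≃⋆ₐ[ℂ]
      (NonUnitalStarAlgebra.adjoin ℂ t).topologicalClosure,
      Isometry Φ ∧ ∀ s (v : (NonUnitalStarAlgebra.adjoin ℂ (range a)).topologicalClosure),
        (v : Adjointable C₀(Y, ℂ) ℋ.L2) = a s → (Φ v : Adjointable C₀(X, ℂ) 𝒢.L2) = b s := by
  subst ht
  refine exists_isometry_starAlgEquiv_of_representations (I := I)
    (C := fun i => 𝒢.FiberL2 (x i) →L[ℂ] 𝒢.FiberL2 (x i))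
    (fun i => ((U i).conjStarAlgEquiv : _ →⋆ₙₐ[ℂ] _).comp (ℋ.fibreRep (y i)))
    (fun i => 𝒢.fibreRep (x i)) (fun T r hr h => norm_le_of_fibreRep hy T hr fun i => ?_)
    (fun T r hr h => norm_le_of_fibreRep hx T hr h) a b fun i s => ?_
  · rw [← NonUnitalStarAlgHom.norm_map (U i).conjStarAlgEquiv (U i).conjStarAlgEquiv.injective]
    exact h i
  · ext1 v
    change U i (ℋ.fibreRep (y i) (a s) ((U i).symm v)) = _
    rw [hab, (U i).apply_symm_apply]

/-- A bijection of fibres that matches the entries of two kernels intertwines the fibres of their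
operators. -/
theorem l2Reindex_fibreRep_op {y : Y} {x : X} (e : ℋ.Fiber y ≃ 𝒢.Fiber x)
    (k : ℋ.TubeKernel) (l : 𝒢.TubeKernel)
    (h : ∀ w w₁, k.matrix y w w₁ = l.matrix x (e w) (e w₁)) (v : ℋ.FiberL2 y) :
    l2Reindex e (ℋ.fibreRep y k.op v) = 𝒢.fibreRep x l.op (l2Reindex e v) := by
  rw [fibreRep_op, fibreRep_op]
  exact IsBandMatrix.l2Reindex_toCLM e _ _ h v

/-- A map `θ` from `C_c(ℋ)` onto the kernels on `𝒢 *_r 𝒢` induces an isomorphism of the reduced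
algebra of `ℋ` onto the uniform algebra of `𝒢`, if for dense families of points `y(i)` and `x(i)`
the matrices of `Λ(f)` over `y(i)` and of `T(θ(f))` over `x(i)` agree up to bijections of the
fibres. Any section of `θ` on the kernels `(γ, γ₁) ↦ f(γ⁻¹ γ₁)` describes the inverse on the reduced
algebra of `𝒢`. -/
theorem exists_reducedCStar_equiv_uniformCStar {I : Type*} {y : I → Y} {x : I → X}
    (hy : DenseRange y) (hx : DenseRange x) (e : ∀ i, ℋ.Fiber (y i) ≃ 𝒢.Fiber (x i))
    (θ : C_c(H, ℂ) → 𝒢.TubeKernel) (hθ : Function.Surjective θ)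
    (h : ∀ i f w w₁, (ℋ.ccKernel f).matrix (y i) w w₁ = (θ f).matrix (x i) (e i w) (e i w₁))
    (τ : C_c(G, ℂ) → C_c(H, ℂ)) (hτ : ∀ f, θ (τ f) = 𝒢.ccKernel f) :
    ∃ Φ : ℋ.reducedCStar ≃⋆ₐ[ℂ] 𝒢.uniformCStar,
      (∀ f : C_c(H, ℂ), Φ (ℋ.regRepReduced f) = 𝒢.opUniform (θ f)) ∧
      ∃ ι : 𝒢.reducedCStar →⋆ₙₐ[ℂ] ℋ.reducedCStar,
        Isometry ι ∧
        (∀ f : C_c(G, ℂ), ι (𝒢.regRepReduced f) = ℋ.regRepReduced (τ f)) ∧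
        ∀ a : 𝒢.reducedCStar,
          (Φ (ι a) : Adjointable C₀(X, ℂ) 𝒢.L2) = (a : Adjointable C₀(X, ℂ) 𝒢.L2) := by
  obtain ⟨Φ, hΦ, hf⟩ := exists_isometry_of_fibreRep hy hx (fun i => l2Reindex (e i)) ℋ.regRep
    (fun f => (θ f).op) (hθ.range_comp (TubeKernel.op (𝒢 := 𝒢)))
    (fun i f v => l2Reindex_fibreRep_op (e i) (ℋ.ccKernel f) (θ f) (h i f) v)
  obtain ⟨ι, hι, hιb, hιa⟩ := exists_isometry_section 𝒢.reducedCStar_le_uniformCStar Φ hΦ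
  refine ⟨Φ, fun f => Subtype.ext (hf f _ rfl), ι, hι, fun f => hιb _ _ ?_, hιa⟩
  exact (hf (τ f) (ℋ.regRepReduced (τ f)) rfl).trans (congrArg TubeKernel.op (hτ f))

end Fibres

/-! ### Density of `𝒢` in `β_r𝒢` -/

section Density

variable {G X : Type*} [TopologicalSpace G] [TopologicalSpace X] {𝒢 : EtaleGroupoid G X}

variable (𝒢) in
/-- `fibreC0` is an ideal in the algebra of all bounded continuous functions on `𝒢`: the product of
`b` and `f`. -/
def idealMul (b : G →ᵇ ℂ) (f : 𝒢.fibreC0) : 𝒢.fibreC0 :=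
  ⟨b * f.1, by
    intro ε hε
    obtain ⟨K, hK, hf⟩ := f.2 (ε / (‖b‖ + 1)) (by positivity)
    refine ⟨K, hK, fun γ hγ => ?_⟩
    have h1 : ‖b γ‖ * ‖f.1 γ‖ ≤ (‖b‖ + 1) * (ε / (‖b‖ + 1)) := by
      have h2 := b.norm_coe_le_norm γ
      have h3 := hf γ hγ
      gcongr
      linarith
    rw [mul_div_cancel₀ _ (by positivity)] at h1
    simpa using h1⟩

theorem BetaR.isInducing_eval : IsInducing fun (z : 𝒢.BetaR) (f : 𝒢.fibreC0) => z f :=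
  IsInducing.comp (g := fun (w : WeakDual ℂ 𝒢.fibreC0) (f : 𝒢.fibreC0) => w f) ⟨rfl⟩
    IsInducing.subtypeVal

variable [T2Space X] [LocallyCompactSpace X]

/-- If a basic neighbourhood `{w : |w(f) - z(f)| < ε_f, f ∈ I}` of a character `z` contains no point
of `𝒢`, then `h = ∑_f ε_f⁻² |f - z(f)|²` is a function on `𝒢` that is bounded below by `1`, so that
multiplication by `h` is onto, although `z` vanishes on its range. -/
theorem denseRange_toBeta : DenseRange (toBeta (𝒢 := 𝒢)) := by
  classical
  intro z
  rw [BetaR.isInducing_eval.closure_eq_preimage_closure_image]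
  refine mem_closure_iff.2 fun O hO hzO => ?_
  obtain ⟨I, u, hu, hOu⟩ := isOpen_pi_iff.1 hO _ hzO
  by_contra hcon
  have hε : ∀ f : I, ∃ ε > 0, Metric.ball (z f.1) ε ⊆ u f.1 := fun f =>
    Metric.isOpen_iff.1 (hu f.1 f.2).1 _ (hu f.1 f.2).2
  choose ε hε0 hεu using hε
  have hfar : ∀ γ : G, ∃ f : I, ε f ≤ ‖f.1.1 γ - z f.1‖ := by
    intro γ
    by_contra! hγ
    refine hcon ⟨_, hOu fun f hf => hεu ⟨f, hf⟩ ?_, ⟨_, ⟨γ, rfl⟩, rfl⟩⟩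
    rw [mem_ball_iff_norm]
    exact hγ ⟨f, hf⟩
  let w : I → (G →ᵇ ℂ) := fun f => f.1.1 - BoundedContinuousFunction.const G (z f.1)
  have hw : ∀ f g, z (𝒢.idealMul (w f) g) = 0 := by
    intro f g
    have : 𝒢.idealMul (w f) g = f.1 * g - z f.1 • g := by
      apply fibreC0_ext
      intro γ
      change (f.1.1 γ - z f.1) * g.1 γ = f.1.1 γ * g.1 γ - z f.1 * g.1 γ
      ring
    rw [this, map_sub, map_mul, map_smul, smul_eq_mul, sub_self]
  let h : G → ℝ := fun γ => ∑ f : I, (ε f)⁻¹ ^ 2 * ‖w f γ‖ ^ 2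
  have h1 : ∀ γ, 1 ≤ h γ := by
    intro γ
    obtain ⟨f, hf⟩ := hfar γ
    have h2 : 1 ≤ (ε f)⁻¹ ^ 2 * ‖w f γ‖ ^ 2 := by
      rw [← mul_pow]
      refine one_le_pow₀ ?_
      rw [inv_mul_eq_div, one_le_div (hε0 f)]
      exact hf
    exact h2.trans (Finset.single_le_sum (f := fun f => (ε f)⁻¹ ^ 2 * ‖w f γ‖ ^ 2)
      (fun f _ => by positivity) (Finset.mem_univ f))
  have hhc : Continuous h := by
    have : ∀ f, Continuous (w f) := fun f => (w f).continuous
    fun_prop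
  let v : G →ᵇ ℂ := BoundedContinuousFunction.ofNormedAddCommGroup
    (fun γ => (((h γ)⁻¹ : ℝ) : ℂ))
    (by
      have : ∀ γ, h γ ≠ 0 := fun γ => (zero_lt_one.trans_le (h1 γ)).ne'
      fun_prop (disch := assumption)) 1 fun γ => by
        have : 0 < h γ := zero_lt_one.trans_le (h1 γ)
        rw [Complex.norm_real, Real.norm_of_nonneg (by positivity)]
        exact inv_le_one_of_one_le₀ (h1 γ)
  obtain ⟨g, hg⟩ := z.exists_ne_zero
  refine hg ?_
  have hsum : g = ∑ f : I, 𝒢.idealMul (w f)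
      ((((ε f)⁻¹ ^ 2 : ℝ) : ℂ) • 𝒢.idealMul (star (w f)) (𝒢.idealMul v g)) := by
    apply fibreC0_ext
    intro γ
    have e : (∑ f : I, 𝒢.idealMul (w f)
        ((((ε f)⁻¹ ^ 2 : ℝ) : ℂ) • 𝒢.idealMul (star (w f)) (𝒢.idealMul v g))).1 γ =
        ∑ f : I, w f γ * ((((ε f)⁻¹ ^ 2 : ℝ) : ℂ) * (star (w f γ) *
          ((((h γ)⁻¹ : ℝ) : ℂ) * g.1 γ))) := by
      simp only [AddSubmonoidClass.coe_finsetSum, BoundedContinuousFunction.sum_apply]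
      rfl
    have e' : ∀ f : I, w f γ * ((((ε f)⁻¹ ^ 2 : ℝ) : ℂ) * (star (w f γ) *
          ((((h γ)⁻¹ : ℝ) : ℂ) * g.1 γ))) =
        (((ε f)⁻¹ ^ 2 * ‖w f γ‖ ^ 2 : ℝ) : ℂ) * ((((h γ)⁻¹ : ℝ) : ℂ) * g.1 γ) := fun f => by
      have := Complex.mul_conj' (w f γ)
      rw [RCLike.star_def]
      push_cast
      rw [← this]
      ring
    rw [e, Finset.sum_congr rfl fun f _ => e' f, ← Finset.sum_mul, ← Complex.ofReal_sum,
      ← _root_.mul_assoc, ← Complex.ofReal_mul]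
    change _ = ((h γ * (h γ)⁻¹ : ℝ) : ℂ) * _
    rw [mul_inv_cancel₀ (zero_lt_one.trans_le (h1 γ)).ne', Complex.ofReal_one, one_mul]
  rw [hsum, map_sum]
  exact Finset.sum_eq_zero fun f _ => hw f _

end Density

/-! ### Surjectivity of `Θ` -/

section Surjectivity

variable {G X : Type*} [TopologicalSpace G] [TopologicalSpace X] {𝒢 : EtaleGroupoid G X}
  [T2Space G] [LocallyCompactSpace G] [T2Space X] [LocallyCompactSpace X]

/-- If `r` is injective on an open set `U` containing the support of `χ`, then
`(γ, γ₁) ↦ χ(γ⁻¹ γ₁) k(γ, γ₁)` is in the range of `Θ`. With the local section `σ : r(U) → U` of `r`,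
the function `η ↦ k(η⁻¹, η⁻¹ σ(r(η)))`, multiplied by a cut-off function, belongs to `fibreC0`, so
that its Gelfand transform is a continuous function on `β_r𝒢`; it is multiplied by `χ` in the second
variable. -/
theorem exists_thetaArrow_eq_mul (k : 𝒢.TubeKernel) {U : Set G} (hU : IsOpen U)
    (hinj : InjOn 𝒢.r U) (χ : C_c(G, ℂ)) (hχ : tsupport χ ⊆ U) :
    ∃ f : C_c(𝒢.betaGSpace.Arrows, ℂ), ∀ p, f (𝒢.thetaArrow p) = χ (𝒢.leftDiv p) * k.1 p := by
  classical
  obtain ⟨ψ, hψ1, hψc, hψU, hψ⟩ :=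
    exists_continuousMap_one_of_isCompact_subset_isOpen χ.hasCompactSupport hU hχ
  have hr : ∀ p : 𝒢.RangePairs, 𝒢.r (𝒢.inv p.1.1) = 𝒢.r (𝒢.leftDiv p) := fun p =>
    (𝒢.r_mul _ _ ((𝒢.s_inv p.1.1).trans p.2)).symm
  -- the kernel in the coordinates `(η, g) = (γ⁻¹, γ⁻¹ γ₁)`, cut off by `ψ`
  let F : G → G → ℂ := fun η g => if h : 𝒢.r η = 𝒢.r g then
    ψ g * k.1 ⟨(𝒢.inv η, 𝒢.leftDiv ⟨(η, g), h⟩), hr ⟨(η, g), h⟩⟩ else 0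
  have hFψ : ∀ η g, F η g ≠ 0 → g ∈ tsupport ψ := by
    intro η g h
    refine subset_tsupport _ fun h0 => h ?_
    simp [F, h0]
  have hF : ContinuousOn (fun z : G × G => F z.1 z.2) {z | 𝒢.r z.1 = 𝒢.r z.2} := by
    rw [continuousOn_iff_continuous_domRestrict]
    have e : Set.domRestrict {z : G × G | 𝒢.r z.1 = 𝒢.r z.2} (fun z => F z.1 z.2)
        = fun p : 𝒢.RangePairs => ψ p.1.2 * k.1 ⟨(𝒢.inv p.1.1, 𝒢.leftDiv p), hr p⟩ := by
      ext p
      have hp : 𝒢.r p.1.1 = 𝒢.r p.1.2 := p.2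
      simp [F, hp]
    rw [e]
    have h1 := k.1.continuous
    have h2 := 𝒢.continuous_inv
    have h3 := 𝒢.continuous_leftDiv
    fun_prop
  -- since `r` is injective on `U`, each fibre sum has at most one nonzero term
  have hval : ∀ η, ∀ g ∈ U, 𝒢.r g = 𝒢.r η → ∑' g' : 𝒢.Fiber (𝒢.r η), F η g' = F η g := by
    intro η g hg hgr
    refine tsum_eq_single (⟨g, hgr⟩ : 𝒢.Fiber (𝒢.r η)) fun g' hg' => ?_
    by_contra h0
    exact hg' (Subtype.ext (hinj (hψU (hFψ _ _ h0)) hg (g'.2.trans hgr.symm)))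
  have hFle : ∀ η g, ‖F η g‖ ≤ ‖k.1‖ := by
    intro η g
    by_cases h : 𝒢.r η = 𝒢.r g
    · simp only [F, dif_pos h]
      rw [norm_mul, Complex.norm_real, Real.norm_of_nonneg (hψ g).1]
      exact (mul_le_of_le_one_left (norm_nonneg _) (hψ g).2).trans (k.1.norm_coe_le_norm _)
    · simp [F, h]
  have hzero : ∀ η, 𝒢.r η ∉ 𝒢.r '' tsupport ψ → ∑' g' : 𝒢.Fiber (𝒢.r η), F η g' = 0 := by
    intro η hη
    refine (tsum_congr fun g' => ?_).trans tsum_zero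
    by_contra h0
    exact hη ⟨g', hFψ _ _ h0, g'.2⟩
  let f : 𝒢.fibreC0 := ⟨BoundedContinuousFunction.ofNormedAddCommGroup
    (fun η => ∑' g' : 𝒢.Fiber (𝒢.r η), F η g')
    (𝒢.continuous_fibreSum 𝒢.continuous_r hF hψc fun η g _ h => hFψ η g h) ‖k.1‖
    fun η => by
      by_cases hη : 𝒢.r η ∈ 𝒢.r '' tsupport ψ
      · obtain ⟨g, hg, hgr⟩ := hη
        rw [hval η g (hψU hg) hgr]
        exact hFle η g
      · rw [hzero η hη, norm_zero]
        exact norm_nonneg _,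
    𝒢.mem_fibreC0_of_compact _ (IsCompact.image hψc 𝒢.continuous_r) hzero⟩
  refine ⟨⟨⟨fun w => w.1.1 f * χ w.1.2, ?_⟩, ?_⟩, fun p => ?_⟩
  · exact ((BetaR.continuous_eval f).comp (by fun_prop)).mul (χ.continuous.comp (by fun_prop))
  · exact (𝒢.pullCc χ).hasCompactSupport.mul_left
  · change (∑' g' : 𝒢.Fiber (𝒢.r (𝒢.inv p.1.1)), F (𝒢.inv p.1.1) g') * χ (𝒢.leftDiv p) = _
    by_cases h0 : χ (𝒢.leftDiv p) = 0
    · rw [h0, mul_zero, zero_mul]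
    · have hg : 𝒢.leftDiv p ∈ tsupport χ := subset_tsupport _ h0
      have e : (⟨(𝒢.inv (𝒢.inv p.1.1), 𝒢.leftDiv ⟨(𝒢.inv p.1.1, 𝒢.leftDiv p), hr p⟩),
          hr ⟨(𝒢.inv p.1.1, 𝒢.leftDiv p), hr p⟩⟩ : 𝒢.RangePairs) = p := by
        refine Subtype.ext (Prod.ext (𝒢.inv_inv _) ?_)
        change 𝒢.mul (𝒢.inv (𝒢.inv p.1.1)) (𝒢.mul (𝒢.inv p.1.1) p.1.2) = p.1.2
        rw [𝒢.inv_inv, 𝒢.inv_mul_cancel_left _ _ p.2]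
      rw [hval _ _ (hχ hg) (hr p).symm, mul_comm]
      simp only [F, dif_pos (hr p)]
      rw [e, hψ1 hg]
      simp

/-- `Θ` is onto: a partition of unity on a compact set containing all `γ⁻¹ γ₁` with
`k(γ, γ₁) ≠ 0` decomposes the kernel `k` into kernels supported in open sets where `r` is
injective. -/
theorem surjective_Theta : Function.Surjective 𝒢.Theta := by
  classical
  intro k
  choose U hU hγU hinj using 𝒢.isLocalHomeomorph_r.isLocallyInjective
  obtain ⟨t, -, ht⟩ := k.isCompact_tubeSet.elim_nhds_subcover U
    fun γ _ => (hU γ).mem_nhds (hγU γ)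
  obtain ⟨ρ, hρU, hρ1, -, hρc⟩ := exists_continuous_sum_one_of_isOpen_isCompact
    (s := fun i : Fin t.card => U (t.equivFin.symm i)) (fun i => hU _) k.isCompact_tubeSet
    (fun γ hγ => by
      obtain ⟨γ₀, hγ₀, h⟩ := mem_iUnion₂.1 (ht hγ)
      exact mem_iUnion.2 ⟨t.equivFin ⟨γ₀, hγ₀⟩, by simpa using h⟩)
  let χ : Fin t.card → C_c(G, ℂ) := fun i =>
    ⟨⟨fun γ => (ρ i γ : ℂ), by fun_prop⟩,
      (hρc i).comp_left (g := ((↑) : ℝ → ℂ)) Complex.ofReal_zero⟩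
  have hχ : ∀ i, tsupport (χ i) ⊆ U (t.equivFin.symm i) := fun i =>
    (closure_mono (Function.support_comp_subset (g := ((↑) : ℝ → ℂ)) Complex.ofReal_zero
      (ρ i))).trans (hρU i)
  choose f hf using fun i =>
    exists_thetaArrow_eq_mul k (hU (t.equivFin.symm i)) (hinj _) (χ i) (hχ i)
  refine ⟨∑ i, f i, Subtype.ext (BoundedContinuousFunction.ext fun p => ?_)⟩
  change (∑ i, f i) (𝒢.thetaArrow p) = k.1 p
  rw [CompactlySupportedContinuousMap.sum_apply, Finset.sum_congr rfl fun i _ => hf i p,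
    ← Finset.sum_mul]
  by_cases h0 : k.1 p = 0
  · rw [h0, mul_zero]
  · have h1 : ∑ i, ρ i (𝒢.leftDiv p) = 1 := by
      simpa using hρ1 (k.mem_tubeSet p h0)
    have h2 : ∑ i, χ i (𝒢.leftDiv p) = 1 := by
      change ∑ i, (ρ i (𝒢.leftDiv p) : ℂ) = 1
      rw [← Complex.ofReal_sum, h1, Complex.ofReal_one]
    rw [h2, one_mul]

end Surjectivity

/-! ### The fibres of `β_r𝒢 ⋊ 𝒢` over points of `𝒢` -/

section Intertwining

variable {G X : Type*} [TopologicalSpace G] [TopologicalSpace X] (𝒢 : EtaleGroupoid G X)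
  [T2Space X] [LocallyCompactSpace X]

/-- The bijection `(i(η), g) ↦ η⁻¹ g` from the fibre of `β_r𝒢 ⋊ 𝒢` over `i(η)` to the fibre of `𝒢`
over `s(η)`. -/
def fibreEquiv (η : G) : 𝒢.betaSemidirect.Fiber (toBeta η) ≃ 𝒢.Fiber (𝒢.s η) where
  toFun w := ⟨𝒢.mul (𝒢.inv η) w.1.1.2, by
    have h : 𝒢.r η = 𝒢.r w.1.1.2 :=
      (q_toBeta η).symm.trans ((congrArg BetaR.q w.2).symm.trans w.1.2)
    rw [𝒢.r_mul _ _ ((𝒢.s_inv η).trans h), 𝒢.r_inv]⟩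
  invFun g := ⟨⟨(toBeta η, 𝒢.mul η g), (q_toBeta η).trans (𝒢.r_mul _ _ g.2.symm).symm⟩, rfl⟩
  left_inv := by
    rintro ⟨⟨⟨z, g⟩, h⟩, rfl : z = toBeta η⟩
    refine Subtype.ext (Subtype.ext (Prod.ext rfl ?_))
    exact 𝒢.inv_mul_cancel_left _ _ ((q_toBeta η).symm.trans h)
  right_inv g := Subtype.ext (𝒢.mul_cancel_left _ _ g.2.symm)

variable [T2Space G]

/-- The matrix entries of `Λ'(f)` over `i(η)` are those of `T(Θ(f))` over `s(η)`, since
`g⁻¹ i(η) = i((η⁻¹ g)⁻¹)`. -/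
theorem matrix_ccKernel_toBeta (f : C_c(𝒢.betaGSpace.Arrows, ℂ)) (η : G)
    (w w₁ : 𝒢.betaSemidirect.Fiber (toBeta η)) :
    (𝒢.betaSemidirect.ccKernel f).matrix (toBeta η) w w₁ =
      (𝒢.Theta f).matrix (𝒢.s η) (𝒢.fibreEquiv η w) (𝒢.fibreEquiv η w₁) := by
  obtain ⟨⟨⟨z, g⟩, h⟩, rfl : z = toBeta η⟩ := w
  obtain ⟨⟨⟨z, g₁⟩, h₁⟩, rfl : z = toBeta η⟩ := w₁
  have hg : 𝒢.r η = 𝒢.r g := (q_toBeta η).symm.trans h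
  have hg₁ : 𝒢.r η = 𝒢.r g₁ := (q_toBeta η).symm.trans h₁
  refine congrArg f (Subtype.ext ?_)
  refine (𝒢.betaGSpace.arrowMul_val (w := 𝒢.betaSemidirect.inv ⟨(toBeta η, g), h⟩)
    (w' := ⟨(toBeta η, g₁), h₁⟩) ((𝒢.s_inv g).trans (hg.symm.trans hg₁))).trans ?_
  have e : 𝒢.inv (𝒢.mul (𝒢.inv η) g) = 𝒢.mul (𝒢.inv g) η := 𝒢.inv_leftDiv ⟨(η, g), hg⟩
  refine Prod.ext ?_ ?_
  · change 𝒢.betaAct (𝒢.inv g) (toBeta η) = toBeta (𝒢.inv (𝒢.mul (𝒢.inv η) g))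
    rw [𝒢.betaAct_toBeta _ _ ((𝒢.s_inv g).trans hg.symm), e]
  · change 𝒢.mul (𝒢.inv g) g₁ = 𝒢.mul (𝒢.inv (𝒢.mul (𝒢.inv η) g)) (𝒢.mul (𝒢.inv η) g₁)
    rw [e, 𝒢.mul_assoc _ _ _ ((𝒢.s_inv g).trans hg.symm), 𝒢.inv_mul_cancel_left _ _ hg₁]
    rw [𝒢.r_mul _ _ ((𝒢.s_inv η).trans hg₁), 𝒢.r_inv]

variable [LocallyCompactSpace G]

/-- The space of arrows of `β_r𝒢 ⋊ 𝒢` is closed in `β_r𝒢 × 𝒢`. -/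
instance : LocallyCompactSpace 𝒢.betaGSpace.Arrows :=
  (IsClosed.isClosedEmbedding_subtypeVal (isClosed_eq (BetaR.continuous_q.comp continuous_fst)
    (𝒢.continuous_r.comp continuous_snd))).locallyCompactSpace

end Intertwining

end EtaleGroupoid

end

theorem mainTheorem5 {G X : Type*} [TopologicalSpace G] [TopologicalSpace X]
    [T2Space G] [LocallyCompactSpace G] [T2Space X] [LocallyCompactSpace X]
    (𝒢 : EtaleGroupoid G X) :
    ∃ Φ : 𝒢.betaSemidirect.reducedCStar ≃⋆ₐ[ℂ] 𝒢.uniformCStar,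
      (∀ f : C_c(𝒢.betaGSpace.Arrows, ℂ),
        Φ (𝒢.betaSemidirect.regRepReduced f) = 𝒢.opUniform (𝒢.Theta f)) ∧
      ∃ ι : 𝒢.reducedCStar →⋆ₙₐ[ℂ] 𝒢.betaSemidirect.reducedCStar,
        Isometry ι ∧
        (∀ f : C_c(G, ℂ), ι (𝒢.regRepReduced f) = 𝒢.betaSemidirect.regRepReduced (𝒢.pullCc f)) ∧
        ∀ a : 𝒢.reducedCStar,
          (Φ (ι a) : Adjointable C₀(X, ℂ) 𝒢.L2) = (a : Adjointable C₀(X, ℂ) 𝒢.L2) :=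
  EtaleGroupoid.exists_reducedCStar_equiv_uniformCStar (EtaleGroupoid.denseRange_toBeta (𝒢 := 𝒢))
    (Function.Surjective.denseRange fun x => ⟨𝒢.e x, 𝒢.s_e x⟩) 𝒢.fibreEquiv 𝒢.Theta
    EtaleGroupoid.surjective_Theta (fun η f => 𝒢.matrix_ccKernel_toBeta f η) 𝒢.pullCc 𝒢.Theta_pullCc
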